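/- Let $X$ be a Banach space and let $(B_j)_{j\in J}$ be a finite family of infinitesimal generators of $C_0$-semigroups $(T_{B_j}(t))_{t\ge0}$ on $X$ that commute with each other: $T_{B_j}(t)T_{B_k}(s)=T_{B_k}(s)T_{B_j}(t)$ for all $s,t\ge 0$ and all $j,k$. Let $n\ge1$ and let $A_1,\dots,A_n$ be a list (in any order) in which each $B_j$ occurs exactly $S_j\ge 1$ times, $\sum_j S_j=n$. Assume that $B_j-B_k$ is injective on $D(B_j)\cap D(B_k)$ whenever $j\ne k$. Let $T>0$. Let $\mathcal D^N$ be the set of vectors on which all products of $N$ of the operators $B_j$ are defined, and let $C([0,T];\mathcal D^N)$ be the set of functions $g:[0,T]\to\mathcal D^N$ such that all products of at most $N$ of the $B_j$, applied to $g$, are continuous on $[0,T]$. Let $M_n$ be the $n\times n$ operator matrix with rows $r=0,\dots,n-1$, columns $(j,k)$, $0\le k<S_j$, and entries $\binom rk B_j^{\,r-k}$ (zero for $k>r$). The vector $M_n\vec y$ is defined if $y_{j,k}\in D(B_j^{\,n-1-k})$ for all $(j,k)$. A solution on $[0,T]$ of $$\prod_{m=1}^n\Bigl(\frac{d}{dt}-A_m\Bigr)u(t)=f(t),\qquad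 u^{(k)}(0)=x_k\quad(0\le k\le n-1)\qquad(*)$$ is a function $u$ with the following properties. There are $u_1=u,u_2,\dots,u_n\in C^1([0,T];X)$ and $u_{n+1}=f$ with $u_m(t)\in D(A_m)$ and $u_{m+1}=u_m'-A_mu_m$ on $[0,T]$ for $1\le m\le n$. Each $u_m$ has at $0$ the value prescribed by the data, that is $u_m(0)=x^{(m)}_0$, where $x^{(1)}_k=x_k$ and $x^{(m+1)}_k=x^{(m)}_{k+1}-A_mx^{(m)}_k$. Moreover $u^{(k)}(0)=x_k$ for every $k\le n-1$ for which $u\in C^k([0,T];X)$. Then: (a) $M_n$ is injective, so that $M_n^{-1}$ is well defined on the range of $M_n$. (b) If the ranges of the differences $B_j-B_k$ are large enough for the data, then the data are in the range of $M_n$. Precisely, there are a finite product $\Delta$ of operators $B_j-B_k$ with $j\neq k$ and a number $N$ such that: if $x_0,\dots,x_{n-1}\in\Delta(\mathcal D^N)$, then there are $y_{j,k}\in\mathcal D^n$ with $M_n\vec y=\vec x=(x_0,\dots,x_{n-1})^T$; and if $f=\Delta g$ on $[0,T]$ with $g\in C([0,T];\mathcal D^N)$, then there are $z_{j,k}\in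 C([0,T];\mathcal D^n)$ with $M_n\vec z(t)=(0,\dots,0,f(t))^T$ for all $t\in[0,T]$. (c) Let $f\in C^1([0,T];X)\cap\bigcup_jC([0,T];[D(B_j)])$, where $[D(B_j)]$ carries the graph norm, and let $x_0,\dots,x_{n-1}\in X$ be arbitrary data. Suppose that the ranges are large enough for $\vec y=M_n^{-1}\vec x$ and $\vec z(t)=M_n^{-1}(0,\dots,0,f(t))^T$ to exist for all $t\in[0,T]$, where each $y_{j,k}$ is in $\mathcal D^n$ and each $z_{j,k}=Z(n;j,k)f$ is continuous on $[0,T]$. Then $$u_h(t)=\sum_j\sum_{k=0}^{S_j-1}\frac{t^k}{k!}T_{B_j}(t)y_{j,k}$$ is a solution of the homogeneous problem ($(*)$ with $f=0$ and data $x_k$) and is in $C^n([0,T];X)$; the function $$u_p(t)=\sum_j\sum_{k=0}^{S_j-1}\int_0^t\frac{(t-s)^k}{k!}T_{B_j}(t-s)z_{j,k}(s)\,ds$$ is a solution of $(*)$ with zero initial data; and $u=u_h+u_p$ is a solution of $(*)$ with right-hand side $f$ and initial data $x_k$. If moreover all $z_{j,k}$ are in $C([0,T];\mathcal D^n)$,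 then $u\in C^n([0,T];X)$, so that $u^{(k)}(0)=x_k$ for all $k\le n-1$. -/

import Mathlib

open Set Filter Topology MeasureTheory
open scoped NNReal

noncomputable section

/-- A strongly continuous semigroup (`C₀`-semigroup) of bounded linear operators. -/
structure C0Semigroup (X : Type*) [NormedAddCommGroup X] [NormedSpace ℝ X] where
  toFun : ℝ≥0 → X →L[ℝ] X
  map_zero : toFun 0 = ContinuousLinearMap.id ℝ X
  map_add : ∀ s t : ℝ≥0, toFun (s + t) = (toFun s).comp (toFun t)
  strong_cont : ∀ x : X, Tendsto (fun t : ℝ≥0 => toFun t x) (𝓝 0) (𝓝 x)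

namespace C0Semigroup

variable {X : Type*} [NormedAddCommGroup X] [NormedSpace ℝ X]

/-- `y = lim_{h → 0+} (S(h) x - x) / h`. -/
def GenRel (S : C0Semigroup X) (x y : X) : Prop :=
  Tendsto (fun h : ℝ≥0 => (h : ℝ)⁻¹ • (S.toFun h x - x)) (𝓝[>] 0) (𝓝 y)

theorem GenRel.unique {S : C0Semigroup X} {x y z : X} (h₁ : S.GenRel x y) (h₂ : S.GenRel x z) :
    y = z := tendsto_nhds_unique h₁ h₂

theorem GenRel.add {S : C0Semigroup X} {x x' y y' : X} (h₁ : S.GenRel x y)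
    (h₂ : S.GenRel x' y') : S.GenRel (x + x') (y + y') := by
  refine (Tendsto.add h₁ h₂).congr fun h => ?_
  rw [_root_.map_add, ← smul_add]
  congr 1
  abel

theorem GenRel.smul {S : C0Semigroup X} {x y : X} (c : ℝ) (h₁ : S.GenRel x y) :
    S.GenRel (c • x) (c • y) := by
  refine (Tendsto.const_smul h₁ c).congr fun h => ?_
  rw [map_smul, ← smul_sub, smul_comm]

theorem GenRel.zero (S : C0Semigroup X) : S.GenRel 0 0 := by
  simp [GenRel]

/-- The infinitesimal generator of a `C₀`-semigroup, with its maximal domain. -/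
def generator (S : C0Semigroup X) : X →ₗ.[ℝ] X where
  domain :=
    { carrier := {x | ∃ y, S.GenRel x y}
      add_mem' := fun ⟨y, hy⟩ ⟨z, hz⟩ => ⟨y + z, hy.add hz⟩
      zero_mem' := ⟨0, GenRel.zero S⟩
      smul_mem' := fun c _ ⟨y, hy⟩ => ⟨c • y, hy.smul c⟩ }
  toFun :=
    { toFun := fun x => Classical.choose x.2
      map_add' := fun x y => GenRel.unique (Classical.choose_spec (x + y).2)
        ((Classical.choose_spec x.2).add (Classical.choose_spec y.2))
      map_smul' := fun c x => GenRel.unique (Classical.choose_spec (c • x).2)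
        ((Classical.choose_spec x.2).smul c) }

end C0Semigroup

namespace FactoredCauchy

variable {X : Type*} [NormedAddCommGroup X] [NormedSpace ℝ X]

open Classical in
/-- `A x` for `x` in the domain of `A` (and `0` for other `x`; below it is only used where
membership in the domain is required or follows). -/
def act (A : X →ₗ.[ℝ] X) (x : X) : X :=
  if h : x ∈ A.domain then A ⟨x, h⟩ else 0

variable {ι : Type*}

/-- The vectors on which all products of `N` of the operators `B j` are defined. -/
def smooth (B : ι → X →ₗ.[ℝ] X) : ℕ → Set X
  | 0 => univ
  | N + 1 => {x | ∀ j, x ∈ (B j).domain ∧ act (B j) x ∈ smooth B N}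

/-- `g` is continuous on `[0,T]`, with values on which all products of `N` of the `B j` are defined,
and all products of at most `N` of the `B j`, applied to `g`, are continuous on `[0,T]`. -/
def SmoothPath (B : ι → X →ₗ.[ℝ] X) (T : ℝ) : ℕ → (ℝ → X) → Prop
  | 0, g => ContinuousOn g (Icc 0 T)
  | N + 1, g => ContinuousOn g (Icc 0 T) ∧
      ∀ j, (∀ t ∈ Icc 0 T, g t ∈ (B j).domain) ∧ SmoothPath B T N (fun t => act (B j) (g t))

/-- The product `(B j₁ - B k₁) ⋯ (B jₚ - B kₚ)` for the list `L = [(j₁,k₁), …, (jₚ,kₚ)]`. -/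
def diffProd (B : ι → X →ₗ.[ℝ] X) (L : List (ι × ι)) (v : X) : X :=
  L.foldr (fun q w => act (B q.1 - B q.2) w) v

/-- The condition `f ∈ C¹([0,T];X) ∩ ⋃ⱼ C([0,T];[D(Bⱼ)])`, with graph norms on the domains. -/
def H1 (B : ι → X →ₗ.[ℝ] X) (T : ℝ) (f : ℝ → X) : Prop :=
  ContDiffOn ℝ 1 f (Icc 0 T) ∧
    ∃ j, (∀ t ∈ Icc 0 T, f t ∈ (B j).domain) ∧ ContinuousOn (fun t => act (B j) (f t)) (Icc 0 T)

variable {n : ℕ}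

/-- The number of factors `d/dt - A_m` (`m < n`, `A_m = B (σ m)`) with `A_m = B j`. -/
def mult [DecidableEq ι] (σ : Fin n → ι) (j : ι) : ℕ :=
  (Finset.univ.filter fun m => σ m = j).card

/-- The columns of the matrix `M_n`: the pairs `(j, k)` with `k < S_j`. -/
abbrev Col [DecidableEq ι] (σ : Fin n → ι) : Type _ := Σ j : ι, Fin (mult σ j)

/-- All entries of column `c = (j, k)` of `M_n` are defined at `y`, that is, `y ∈ D(B_j^{n-1-k})`. -/
def InDom [DecidableEq ι] (B : ι → X →ₗ.[ℝ] X) (σ : Fin n → ι) (c : Col σ) (y : X) : Prop :=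
  ∀ p : ℕ, p + 1 + (c.2 : ℕ) < n → (act (B c.1))^[p] y ∈ (B c.1).domain

/-- The vector `M_n y`: the entry of `M_n` in row `r` (`0 ≤ r < n`) and column `(j, k)` is
`C(r,k) B_j^{r-k}`, which is zero for `k > r`. -/
def mulM [Fintype ι] [DecidableEq ι] (B : ι → X →ₗ.[ℝ] X) (σ : Fin n → ι) (y : Col σ → X) :
    Fin n → X :=
  fun r => ∑ c : Col σ, (Nat.choose r c.2 : ℝ) • (act (B c.1))^[(r : ℕ) - c.2] (y c)

/-- The vector `(0, …, 0, w)`. -/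
def lastVec (n : ℕ) (w : X) : Fin n → X :=
  fun r => if (r : ℕ) + 1 = n then w else 0

/-- `shiftedData B σ x m k` is the prescribed `k`-th derivative at `0` of
`(d/dt - A_{m-1}) ⋯ (d/dt - A_0) u` (`k + m < n`), computed from the data `u^{(k)}(0) = x_k`. -/
def shiftedData (B : ι → X →ₗ.[ℝ] X) (σ : Fin n → ι) (x : Fin n → X) : ℕ → ℕ → X
  | 0, k => if h : k < n then x ⟨k, h⟩ else 0
  | m + 1, k =>
      if h : m < n then
        shiftedData B σ x m (k + 1) - act (B (σ ⟨m, h⟩)) (shiftedData B σ x m k)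
      else 0

/-- `u` solves `∏_{m<n} (d/dt - A_m) u = f` on `[0,T]`, `u^{(k)}(0) = x_k` for `k < n`, where
`A_m = B (σ m)`. The product of operators is applied factor by factor:
`v 0 = u`, `v (m+1) = (d/dt - A_m) (v m)`, `v n = f`, where `v m` for `m < n` is continuously
differentiable with values in `D(A_m)`. Each `v m` has at `0` the value that the data `x` prescribe
for it, and `u^{(k)}(0) = x_k` for every `k < n` for which `u ∈ C^k([0,T];X)`. -/
def IsSolution (B : ι → X →ₗ.[ℝ] X) (σ : Fin n → ι) (T : ℝ) (x : Fin n → X) (f u : ℝ → X) :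
    Prop :=
  (∃ v : ℕ → ℝ → X,
    (∀ t ∈ Icc 0 T, v 0 t = u t) ∧ (∀ t ∈ Icc 0 T, v n t = f t) ∧
    ∀ m : Fin n,
      (∀ t ∈ Icc 0 T, v m t ∈ (B (σ m)).domain ∧
        HasDerivWithinAt (v m) (act (B (σ m)) (v m t) + v ((m : ℕ) + 1) t) (Icc 0 T) t) ∧
      ContinuousOn (derivWithin (v m) (Icc 0 T)) (Icc 0 T) ∧
      v m 0 = shiftedData B σ x m 0) ∧
  ∀ k : Fin n, ContDiffOn ℝ (k : ℕ) u (Icc 0 T) → iteratedDerivWithin k u (Icc 0 T) 0 = x k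

/-- `∑_j ∑_{k < S_j} t^k / k! T_{B_j}(t) y(j,k)`. -/
def homSol [Fintype ι] [DecidableEq ι] (S : ι → C0Semigroup X) (σ : Fin n → ι) (y : Col σ → X)
    (t : ℝ) : X :=
  ∑ c : Col σ, (t ^ (c.2 : ℕ) / (Nat.factorial c.2 : ℝ)) • (S c.1).toFun t.toNNReal (y c)

/-- `∑_j ∑_{k < S_j} ∫_0^t (t-s)^k / k! T_{B_j}(t-s) z(j,k)(s) ds`. -/
def inhomSol [Fintype ι] [DecidableEq ι] (S : ι → C0Semigroup X) (σ : Fin n → ι)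
    (z : Col σ → ℝ → X) (t : ℝ) : X :=
  ∑ c : Col σ, ∫ s in (0 : ℝ)..t,
    ((t - s) ^ (c.2 : ℕ) / (Nat.factorial c.2 : ℝ)) • (S c.1).toFun (t - s).toNNReal (z c s)

end FactoredCauchy

end

/-! Each generator `B j` has a bounded injective resolvent `R j = (l j - B j)⁻¹`, and these
resolvents commute with each other and with all the semigroups. In the commutative ring `bicommutant
S`, invert every operator that is injective on `X`. Then `X` embeds into the localized module, `B j`
becomes multiplication by the fraction `b j = (l j R j - 1) / R j`, and `x ∈ D(B j)` means that `b
j` maps `x` back into `X`. All questions about domains become questions about ranges of `e`, and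
injectivity of `B j - B k` says that `b j - b k` annihilates no nonzero element (`exists_model`).

In this model `M_n` is a confluent Vandermonde matrix over a commutative ring. Hermite interpolation
gives a matrix `W` that inverts it on both sides up to a product `d` of differences
(`exists_confluent_inverse`). The left inverse proves (a). The right inverse, taken over integer
polynomials, proves (b): the entries of `W` are polynomials in the `B j`, which can be applied to
sufficiently smooth vectors.

For (c) with smooth coefficients, applying `d/dt - A` to `∑ t^k/k! T_j(t) y(j,k)` replaces `y(j,k)`
by `y(j,k+1) + (B_j - A) y(j,k)`. A factor `A = B_j` thus shortens column `j` by one, and all `n`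
factors together leave nothing. The convolution terms obey the same rule, plus a boundary term `∑_j
z(j,0)`. The equations `M_n z = (0,…,0,f)` make this term vanish until the last factor, where it is
`f`. Pascal's rule (`Model.row_step`) identifies the initial values with the rows of `M_n y`.

If `z` is only continuous, these differentiations are not available. Since `f` is `C¹`, a chain of
classical solutions with zero data can instead be built one factor at a time. After application of
`Q ^ n`, with `Q` the injective product of all resolvents, the formula and this chain satisfy the
same smooth problem. Uniqueness and injectivity of `Q ^ n` identify them (`famSol_eq_of_isChain`).
The same device shows that those time derivatives at `0` that exist vanish. -/

noncomputable section

/-! ### Semigroups: joint continuity and existence of a resolvent -/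

namespace C0Semigroup

open FactoredCauchy

variable {X : Type*} [NormedAddCommGroup X] [NormedSpace ℝ X]

/-- Otherwise there are times tending to `0` with unbounded norms, although strong continuity at `0`
bounds these operators pointwise; this contradicts Banach–Steinhaus. -/
theorem exists_norm_le_near_zero [CompleteSpace X] (S : C0Semigroup X) :
    ∃ δ : ℝ≥0, 0 < δ ∧ ∃ M : ℝ, ∀ t ≤ δ, ‖S.toFun t‖ ≤ M := by
  by_contra! H
  have h1 : ∀ n : ℕ, ∃ t : ℝ≥0, t ≤ 1 / ((n : ℝ≥0) + 1) ∧ (n : ℝ) < ‖S.toFun t‖ := fun n =>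
    H _ (by positivity) n
  choose t ht htn using h1
  have ht0 : Tendsto t atTop (𝓝 0) :=
    tendsto_of_tendsto_of_tendsto_of_le_of_le tendsto_const_nhds
      (tendsto_one_div_add_atTop_nhds_zero_nat (𝕜 := ℝ≥0)) (fun _ => zero_le) ht
  obtain ⟨C, hC⟩ := banach_steinhaus (g := fun n => S.toFun (t n)) fun x => by
    obtain ⟨C, hC⟩ := (((S.strong_cont x).comp ht0).norm).bddAbove_range
    exact ⟨C, fun i => hC ⟨i, rfl⟩⟩
  obtain ⟨n, hn⟩ := exists_nat_gt C
  exact absurd (hC n) (not_le.2 (hn.trans (htn n)))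

theorem exists_norm_le [CompleteSpace X] (S : C0Semigroup X) (a : ℝ≥0) :
    ∃ M : ℝ, 0 ≤ M ∧ ∀ t ≤ a, ‖S.toFun t‖ ≤ M := by
  obtain ⟨δ, hδ, M, hM⟩ := S.exists_norm_le_near_zero
  have h1 : ∀ n : ℕ, ∀ t ≤ n * δ, ‖S.toFun t‖ ≤ max M 1 ^ n * max M 1 := by
    intro n
    induction n with
    | zero =>
      intro t ht
      have : t ≤ δ := (by simpa using ht : t = 0).le.trans zero_le
      simpa using Or.inl (hM t this)
    | succ n ih =>
      intro t ht
      rcases le_total t δ with h | h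
      · refine (hM t h).trans ((le_max_left M 1).trans ?_)
        exact le_mul_of_one_le_left (by positivity) (one_le_pow₀ (le_max_right _ _))
      · have e : t = δ + (t - δ) := (add_tsub_cancel_of_le h).symm
        rw [e, S.map_add]
        refine (ContinuousLinearMap.opNorm_comp_le _ _).trans ?_
        rw [pow_succ', mul_assoc]
        refine mul_le_mul ((hM δ le_rfl).trans (le_max_left _ _)) (ih _ ?_) (norm_nonneg _)
          (by positivity)
        rw [tsub_le_iff_right]
        push_cast at ht
        linarith
  obtain ⟨n, hn⟩ := exists_nat_ge (a / δ)
  refine ⟨max M 1 ^ n * max M 1, by positivity, fun t ht => h1 n t (ht.trans ?_)⟩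
  rwa [div_le_iff₀ hδ] at hn

theorem map_add_apply (S : C0Semigroup X) (s t : ℝ≥0) (x : X) :
    S.toFun (s + t) x = S.toFun s (S.toFun t x) := by
  rw [S.map_add]; rfl

theorem continuous_uncurry [CompleteSpace X] (S : C0Semigroup X) :
    Continuous fun p : ℝ≥0 × X => S.toFun p.1 p.2 := by
  rw [continuous_iff_continuousAt]
  rintro ⟨t₀, x₀⟩
  obtain ⟨M, hM0, hM⟩ := S.exists_norm_le (t₀ + 1)
  -- The smaller of the two times is factored out, so that only continuity at `0` is needed, from
  -- the left of `t₀` as well as from the right.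
  have key : ∀ t ≤ t₀ + 1, ‖S.toFun t x₀ - S.toFun t₀ x₀‖ ≤
      M * ‖S.toFun (nndist t t₀) x₀ - x₀‖ := by
    intro t ht
    rcases le_total t t₀ with h | h
    · have e : t₀ = t + nndist t t₀ := by
        apply NNReal.eq
        have h' : (t : ℝ) ≤ t₀ := h
        rw [NNReal.coe_add, coe_nndist, NNReal.dist_eq, abs_of_nonpos (by linarith)]
        ring
      conv_lhs => rw [e, map_add_apply, ← map_sub, ← norm_neg, ← map_neg, neg_sub]
      exact (S.toFun t).le_of_opNorm_le (hM t ht) _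
    · have e : t = t₀ + nndist t t₀ := by
        apply NNReal.eq
        have h' : (t₀ : ℝ) ≤ t := h
        rw [NNReal.coe_add, coe_nndist, NNReal.dist_eq, abs_of_nonneg (by linarith)]
        ring
      conv_lhs => rw [e, map_add_apply, ← map_sub]
      exact (S.toFun t₀).le_of_opNorm_le (hM t₀ (by simp)) _
  rw [ContinuousAt, tendsto_iff_norm_sub_tendsto_zero]
  have hlim : Tendsto (fun p : ℝ≥0 × X => M * ‖p.2 - x₀‖ +
      M * ‖S.toFun (nndist p.1 t₀) x₀ - x₀‖) (𝓝 (t₀, x₀)) (𝓝 (M * 0 + M * 0)) := by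
    refine (Tendsto.const_mul _ ?_).add (Tendsto.const_mul _ ?_)
    · exact tendsto_iff_norm_sub_tendsto_zero.1 (continuous_snd.tendsto (t₀, x₀))
    · refine tendsto_iff_norm_sub_tendsto_zero.1 ((S.strong_cont x₀).comp ?_)
      have : Continuous fun p : ℝ≥0 × X => nndist p.1 t₀ := by fun_prop
      simpa using this.tendsto (t₀, x₀)
  refine squeeze_zero' (Eventually.of_forall fun _ => norm_nonneg _) ?_ (by simpa using hlim)
  have hev : ∀ᶠ p : ℝ≥0 × X in 𝓝 (t₀, x₀), p.1 < t₀ + 1 :=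
    (continuous_fst.tendsto (t₀, x₀)).eventually (gt_mem_nhds (by simp))
  filter_upwards [hev] with p hp
  calc ‖S.toFun p.1 p.2 - S.toFun t₀ x₀‖
      = ‖S.toFun p.1 (p.2 - x₀) + (S.toFun p.1 x₀ - S.toFun t₀ x₀)‖ := by
        rw [map_sub]; congr 1; abel
    _ ≤ _ := norm_add_le_of_le ((S.toFun p.1).le_of_opNorm_le (hM _ hp.le) _) (key _ hp.le)

theorem continuous_apply [CompleteSpace X] (S : C0Semigroup X) {α : Type*} [TopologicalSpace α]
    {f : α → ℝ} {g : α → X} (hf : Continuous f) (hg : Continuous g) :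
    Continuous fun a => S.toFun (f a).toNNReal (g a) :=
  S.continuous_uncurry.comp ((continuous_real_toNNReal.comp hf).prodMk hg)

theorem act_generator {S : C0Semigroup X} {x y : X} (h : S.GenRel x y) :
    x ∈ S.generator.domain ∧ act S.generator x = y := by
  have hx : x ∈ S.generator.domain := ⟨y, h⟩
  refine ⟨hx, ?_⟩
  rw [act, dif_pos hx]
  exact GenRel.unique (Classical.choose_spec hx) h

theorem genRel_act {S : C0Semigroup X} {x : X} (h : x ∈ S.generator.domain) :
    S.GenRel x (act S.generator x) := by
  obtain ⟨y, hy⟩ := h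
  rwa [(act_generator hy).2]

theorem GenRel.map {S : C0Semigroup X} {x y : X} (h : S.GenRel x y) {C : X →L[ℝ] X}
    (hC : ∀ t, Commute C (S.toFun t)) : S.GenRel (C x) (C y) := by
  refine ((C.continuous.tendsto y).comp h).congr fun t => ?_
  have : C (S.toFun t x) = S.toFun t (C x) := DFunLike.congr_fun (hC t).eq x
  simp [this]

theorem genRel_of_hasDerivWithinAt {S : C0Semigroup X} {x y : X}
    (h : HasDerivWithinAt (fun t : ℝ => S.toFun t.toNNReal x) y (Ici 0) 0) : S.GenRel x y := by
  rw [hasDerivWithinAt_iff_tendsto_slope] at h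
  have hc : Tendsto (fun t : ℝ≥0 => (t : ℝ)) (𝓝[>] 0) (𝓝[Ici 0 \ {0}] 0) := by
    rw [tendsto_nhdsWithin_iff]
    refine ⟨(NNReal.continuous_coe.tendsto 0).mono_left nhdsWithin_le_nhds, ?_⟩
    filter_upwards [self_mem_nhdsWithin] with t ht
    exact ⟨t.2, by simpa using (ne_of_gt ht)⟩
  refine (h.comp hc).congr fun t => ?_
  simp [slope, S.map_zero]

/-- The truncated Laplace transform `∫₀¹ e^{-ls} T(s) x ds`. -/
def truncLaplace [CompleteSpace X] (S : C0Semigroup X) (l : ℝ) : X →L[ℝ] X :=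
  have hcont : ∀ x : X, Continuous fun s : ℝ => Real.exp (-l * s) • S.toFun s.toNNReal x :=
    fun x => (by fun_prop : Continuous fun s : ℝ => Real.exp (-l * s)).smul
      (S.continuous_apply continuous_id continuous_const)
  have hM := S.exists_norm_le 1
  LinearMap.mkContinuous
    { toFun := fun x => ∫ s in (0 : ℝ)..1, Real.exp (-l * s) • S.toFun s.toNNReal x
      map_add' := fun x y => by
        rw [← intervalIntegral.integral_add ((hcont x).intervalIntegrable _ _)
          ((hcont y).intervalIntegrable _ _)]
        simp
      map_smul' := fun c x => by
        rw [RingHom.id_apply, ← intervalIntegral.integral_smul]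
        simp only [map_smul, smul_comm c] }
    (Real.exp |l| * hM.choose) fun x => by
      refine (intervalIntegral.norm_integral_le_of_norm_le_const
        (C := Real.exp |l| * hM.choose * ‖x‖) fun s hs => ?_).trans (by simp)
      rw [uIoc_of_le zero_le_one] at hs
      rw [norm_smul, mul_assoc, Real.norm_of_nonneg (Real.exp_pos _).le]
      refine mul_le_mul (Real.exp_le_exp.2 ?_) ((S.toFun _).le_of_opNorm_le
        (hM.choose_spec.2 _ ?_) _) (norm_nonneg _) (Real.exp_pos _).le
      · nlinarith [neg_abs_le l, abs_nonneg l, hs.1, hs.2]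
      · simpa using hs.2

theorem truncLaplace_apply [CompleteSpace X] (S : C0Semigroup X) (l : ℝ) (x : X) :
    S.truncLaplace l x = ∫ s in (0 : ℝ)..1, Real.exp (-l * s) • S.toFun s.toNNReal x := rfl

theorem continuous_exp_smul [CompleteSpace X] (S : C0Semigroup X) (l : ℝ) (x : X) :
    Continuous fun s : ℝ => Real.exp (-l * s) • S.toFun s.toNNReal x :=
  (by fun_prop : Continuous fun s : ℝ => Real.exp (-l * s)).smul
    (S.continuous_apply continuous_id continuous_const)

theorem commute_truncLaplace [CompleteSpace X] (S : C0Semigroup X) (l : ℝ) {C : X →L[ℝ] X}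
    (hC : ∀ t, Commute C (S.toFun t)) : Commute C (S.truncLaplace l) := by
  ext x
  change C (S.truncLaplace l x) = S.truncLaplace l (C x)
  rw [truncLaplace_apply, truncLaplace_apply,
    ← ContinuousLinearMap.intervalIntegral_comp_comm _
      ((S.continuous_exp_smul l x).intervalIntegrable _ _)]
  refine intervalIntegral.integral_congr fun s _ => ?_
  have : C (S.toFun s.toNNReal x) = S.toFun s.toNNReal (C x) :=
    DFunLike.congr_fun (hC _).eq x
  simp [this]

/-- The semigroup law shifts the window `[0,1]` to `[t,t+1]`. Now `t` occurs only in a scalar factor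
and in the limits of integration, so the orbit is differentiable for every `x`. -/
theorem toFun_truncLaplace [CompleteSpace X] (S : C0Semigroup X) (l : ℝ) (x : X) {t : ℝ}
    (ht : 0 ≤ t) : S.toFun t.toNNReal (S.truncLaplace l x) = Real.exp (l * t) •
      ∫ s in t..(t + 1), Real.exp (-l * s) • S.toFun s.toNNReal x := by
  rw [truncLaplace_apply, ← ContinuousLinearMap.intervalIntegral_comp_comm _
      ((S.continuous_exp_smul l x).intervalIntegrable _ _),
    ← intervalIntegral.integral_smul]
  have := intervalIntegral.integral_comp_add_right (a := 0) (b := 1)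
    (fun s => Real.exp (l * t) • Real.exp (-l * s) • S.toFun s.toNNReal x) t
  rw [zero_add, add_comm 1 t] at this
  rw [← this]
  refine intervalIntegral.integral_congr fun s hs => ?_
  rw [uIcc_of_le zero_le_one] at hs
  simp only [map_smul]
  rw [smul_smul, ← Real.exp_add, add_comm s t, Real.toNNReal_add ht hs.1, map_add_apply]
  congr 2
  ring

theorem hasDerivWithinAt_truncLaplace [CompleteSpace X] (S : C0Semigroup X) (l : ℝ) (x : X)
    {t : ℝ} (ht : 0 ≤ t) :
    HasDerivWithinAt (fun t : ℝ => S.toFun t.toNNReal (S.truncLaplace l x))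
      (S.toFun t.toNNReal (l • S.truncLaplace l x + (Real.exp (-l) • S.toFun 1 x - x)))
      (Ici 0) t := by
  have hc := S.continuous_exp_smul l x
  have h1 : ∀ a : ℝ, HasDerivAt
      (fun t => ∫ s in (0 : ℝ)..t, Real.exp (-l * s) • S.toFun s.toNNReal x)
      (Real.exp (-l * a) • S.toFun a.toNNReal x) a := fun a =>
    (hc.integral_hasStrictDerivAt 0 a).hasDerivAt
  have h2 : HasDerivAt (fun t : ℝ => ∫ s in t..(t + 1),
      Real.exp (-l * s) • S.toFun s.toNNReal x)
      (Real.exp (-l * (t + 1)) • S.toFun (t + 1).toNNReal x -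
        Real.exp (-l * t) • S.toFun t.toNNReal x) t := by
    refine (((h1 (t + 1)).comp_add_const t 1).sub (h1 t)).congr_of_eventuallyEq ?_
    refine Eventually.of_forall fun a => ?_
    rw [Pi.sub_apply]
    exact (intervalIntegral.integral_interval_sub_left (hc.intervalIntegrable _ _)
      (hc.intervalIntegrable _ _)).symm
  have h3 : HasDerivAt (fun t : ℝ => Real.exp (l * t)) (Real.exp (l * t) * l) t := by
    simpa using ((hasDerivAt_id t).const_mul l).exp
  refine ((h3.smul h2).hasDerivWithinAt.congr (fun a ha => S.toFun_truncLaplace l x ha)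
    (S.toFun_truncLaplace l x ht)).congr_deriv ?_
  rw [_root_.map_add, map_smul, S.toFun_truncLaplace l x ht, map_sub, map_smul, smul_sub,
    smul_smul, smul_smul, smul_smul, ← Real.exp_add, ← Real.exp_add,
    Real.toNNReal_add ht zero_le_one, map_add_apply, Real.toNNReal_one,
    show l * t + -l * (t + 1) = -l by ring, show l * t + -l * t = 0 by ring, Real.exp_zero,
    one_smul, add_comm, mul_comm (Real.exp (l * t))]

/-- Some point of the resolvent set, with its resolvent operator. -/
theorem exists_resolvent [CompleteSpace X] (S : C0Semigroup X) :
    ∃ (l : ℝ) (R : X →L[ℝ] X),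
      (∀ C : X →L[ℝ] X, (∀ t, Commute C (S.toFun t)) → Commute C R) ∧
      (∀ x x', R (l • x - x') = x ↔ x ∈ S.generator.domain ∧ act S.generator x = x') ∧
      ∀ (x : X) (t : ℝ), 0 ≤ t → HasDerivWithinAt (fun t : ℝ => S.toFun t.toNNReal (R x))
        (S.toFun t.toNNReal (l • R x - x)) (Ici 0) t := by
  -- With `L` the truncated transform and `A` the generator, `(l - A) L = 1 - e^{-l} T(1)`. This `l`
  -- makes `‖e^{-l} T(1)‖ < 1`, so the right side is a unit by the Neumann series and `R = L U⁻¹`;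
  -- no growth bound for the semigroup is needed.
  set l : ℝ := Real.log (‖S.toFun 1‖ + 1) with hl
  have hp : (0 : ℝ) < ‖S.toFun 1‖ + 1 := by positivity
  have hexp : Real.exp (-l) = (‖S.toFun 1‖ + 1)⁻¹ := by
    rw [Real.exp_neg, hl, Real.exp_log hp]
  have hlt : ‖Real.exp (-l) • S.toFun 1‖ < 1 := by
    rw [norm_smul, hexp, Real.norm_of_nonneg (by positivity), inv_mul_lt_iff₀ hp]
    linarith
  set U := Units.oneSub _ hlt with hU
  have hUv : ∀ x, (U : X →L[ℝ] X) x = x - Real.exp (-l) • S.toFun 1 x := fun x => rfl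
  set R : X →L[ℝ] X := S.truncLaplace l * (↑U⁻¹ : X →L[ℝ] X) with hR
  have hcomm : ∀ C : X →L[ℝ] X, (∀ t, Commute C (S.toFun t)) → Commute C R := by
    intro C hC
    refine (S.commute_truncLaplace l hC).mul_right (Commute.units_inv_right ?_)
    rw [hU, Units.val_oneSub]
    exact (Commute.one_right C).sub_right ((hC 1).smul_right _)
  have hder : ∀ (x : X) (t : ℝ), 0 ≤ t →
      HasDerivWithinAt (fun t : ℝ => S.toFun t.toNNReal (R x))
        (S.toFun t.toNNReal (l • R x - x)) (Ici 0) t := by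
    intro x t ht
    have h1 : x = (U : X →L[ℝ] X) ((↑U⁻¹ : X →L[ℝ] X) x) := by
      rw [← mul_apply_eq_comp, Units.mul_inv]; rfl
    refine (S.hasDerivWithinAt_truncLaplace l ((↑U⁻¹ : X →L[ℝ] X) x) ht).congr_deriv ?_
    congr 1
    have h2 : l • R x - x = l • R x - (U : X →L[ℝ] X) ((↑U⁻¹ : X →L[ℝ] X) x) := by rw [← h1]
    rw [h2, hUv, sub_sub_eq_add_sub, add_sub_assoc]
    rfl
  have hgen : ∀ x, S.GenRel (R x) (l • R x - x) := fun x => by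
    have := hder x 0 le_rfl
    rw [Real.toNNReal_zero, S.map_zero] at this
    exact genRel_of_hasDerivWithinAt this
  refine ⟨l, R, hcomm, fun x x' => ⟨fun h => ?_, fun h => ?_⟩, hder⟩
  · have := hgen (l • x - x')
    rw [h, sub_sub_cancel] at this
    exact act_generator this
  -- Since `R` commutes with the semigroup, the generator maps `R x` to `R x'`; it also maps it to
  -- `l R x - x`.
  · have hx := genRel_act h.1
    rw [h.2] at hx
    have hRT : ∀ t, Commute R (S.toFun t) := fun t => by
      refine (hcomm _ fun s => ?_).symm
      change (S.toFun t).comp (S.toFun s) = (S.toFun s).comp (S.toFun t)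
      rw [← S.map_add, ← S.map_add, add_comm]
    have := (hx.map hRT).unique (hgen x)
    rw [map_sub, map_smul, this, sub_sub_cancel]

end C0Semigroup

/-! ### Confluent Vandermonde matrices over commutative rings -/

namespace FactoredCauchy

variable {ι : Type*} [Fintype ι] [DecidableEq ι] {n : ℕ} (σ : Fin n → ι)

/-- The confluent Vandermonde matrix. -/
def confluent {A : Type*} [CommRing A] (x : ι → A) : Matrix (Fin n) (Col σ) A :=
  fun r c => (Nat.choose r c.2 : A) * x c.1 ^ ((r : ℕ) - c.2)

theorem sum_mult : ∑ j, mult σ j = n := by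
  have := Finset.card_eq_sum_card_fiberwise (f := σ) (s := Finset.univ) (t := Finset.univ)
    (fun _ _ => Finset.mem_coe.2 (Finset.mem_univ _))
  simpa [mult] using this.symm

theorem card_col : Fintype.card (Col σ) = n := by
  simp [sum_mult]

open Polynomial in
-- Multiplying the matrix from the left by the coefficients of `p` evaluates the Hasse derivatives
-- of `p` at the nodes, so inverting it is Hermite interpolation. Hasse derivatives avoid division
-- by `k!`.
theorem eval_hasseDeriv {A : Type*} [CommRing A] (p : A[X]) (hp : p.natDegree < n) (k : ℕ)
    (a : A) : (hasseDeriv k p).eval a =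
      ∑ r : Fin n, p.coeff r * ((Nat.choose r k : A) * a ^ ((r : ℕ) - k)) := by
  rw [hasseDeriv_apply, sum_over_range' p (by simp) n hp, eval_finsetSum, Finset.sum_range]
  refine Finset.sum_congr rfl fun r _ => ?_
  rw [eval_monomial]
  ring

open Polynomial in
/-- The polynomial with a zero of order `k` at `x j` and of order `mult σ l` at the other `x l`. -/
def hermitePoly {A : Type*} [CommRing A] (x : ι → A) (c : Col σ) : A[X] :=
  (X - C (x c.1)) ^ (c.2 : ℕ) * ∏ l ∈ Finset.univ.erase c.1, (X - C (x l)) ^ mult σ l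

open Polynomial in
theorem natDegree_hermitePoly_lt {A : Type*} [CommRing A] (x : ι → A) (c : Col σ) :
    (hermitePoly σ x c).natDegree < n := by
  rcases subsingleton_or_nontrivial A with hA | hA
  · rw [Subsingleton.elim (hermitePoly σ x c) 0, natDegree_zero, ← sum_mult σ]
    exact Finset.sum_pos' (fun _ _ => zero_le) ⟨c.1, Finset.mem_univ _, c.2.pos⟩
  have h1 : (hermitePoly σ x c).natDegree ≤
      c.2 + ∑ l ∈ Finset.univ.erase c.1, mult σ l := by
    refine natDegree_mul_le.trans (add_le_add ?_ ((natDegree_prod_le _ _).trans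
      (Finset.sum_le_sum fun l _ => ?_)))
    · exact (natDegree_pow_le).trans (by simp)
    · exact (natDegree_pow_le).trans (by simp)
  have h2 := Finset.add_sum_erase Finset.univ (mult σ) (Finset.mem_univ c.1)
  rw [sum_mult] at h2
  have := c.2.2
  omega

open Polynomial in
-- Hasse derivatives at `a` are the Taylor coefficients at `a`, which multiplication by `(X - a)^m`
-- shifts by `m`.
theorem eval_hasseDeriv_X_sub_C_pow_mul {A : Type*} [CommRing A] (a : A) (q : A[X]) (m k : ℕ) :
    (hasseDeriv k ((X - C a) ^ m * q)).eval a =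
      if m ≤ k then (taylor a q).coeff (k - m) else 0 := by
  rw [← taylor_coeff, taylor_mul, taylor_pow, map_sub, taylor_X, taylor_C, add_sub_cancel_right,
    coeff_X_pow_mul']

/-- The products of differences `x j - x k`, `j ≠ k`. -/
def diffSubmonoid {A : Type*} [CommRing A] (x : ι → A) : Submonoid A :=
  Submonoid.closure {a | ∃ q : ι × ι, q.1 ≠ q.2 ∧ a = x q.1 - x q.2}

omit [Fintype ι] [DecidableEq ι] in
theorem sub_mem_diffSubmonoid {A : Type*} [CommRing A] (x : ι → A) {j k : ι} (h : j ≠ k) :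
    x j - x k ∈ diffSubmonoid x :=
  Submonoid.subset_closure ⟨(j, k), h, rfl⟩

omit [Fintype ι] [DecidableEq ι] in
theorem exists_list_of_mem_diffSubmonoid {A : Type*} [CommRing A] {x : ι → A} {a : A}
    (ha : a ∈ diffSubmonoid x) :
    ∃ L : List (ι × ι), (∀ q ∈ L, q.1 ≠ q.2) ∧ (L.map fun q => x q.1 - x q.2).prod = a := by
  induction ha using Submonoid.closure_induction with
  | mem a h =>
    obtain ⟨q, hq, rfl⟩ := h
    exact ⟨[q], by simpa using hq, by simp⟩
  | one => exact ⟨[], by simp, by simp⟩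
  | mul a b _ _ ha hb =>
    obtain ⟨L, h1, h2⟩ := ha
    obtain ⟨L', h1', h2'⟩ := hb
    refine ⟨L ++ L', fun q hq => ?_, by simp [h2, h2']⟩
    rcases List.mem_append.1 hq with h | h
    · exact h1 q h
    · exact h1' q h

open Polynomial in
/-- A matrix inverting the confluent Vandermonde matrix up to a product of differences. -/
theorem exists_confluent_inverse {A : Type*} [CommRing A] (x : ι → A) :
    ∃ W : Matrix (Col σ) (Fin n) A, ∃ d ∈ diffSubmonoid x,
      W * confluent σ x = d • (1 : Matrix (Col σ) (Col σ) A) ∧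
      confluent σ x * W = d • (1 : Matrix (Fin n) (Fin n) A) := by
  let ε : Col σ ≃ Fin n := Fintype.equivFinOfCardEq (card_col σ)
  -- The polynomial of row `(j,k)` vanishes to full order at the other nodes and to order `k` at `x
  -- j`. So `P` is block diagonal with triangular blocks, and its diagonal entries are products of
  -- differences.
  let H : Matrix (Col σ) (Fin n) A := fun c r => (hermitePoly σ x c).coeff r
  let P : Matrix (Col σ) (Col σ) A := H * confluent σ x
  have hP : ∀ c c', P c c' = (hasseDeriv c'.2 (hermitePoly σ x c)).eval (x c'.1) := fun c c' =>
    (eval_hasseDeriv _ (natDegree_hermitePoly_lt σ x c) _ _).symm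
  have hdet : P.det ∈ diffSubmonoid x := by
    -- The lexicographic order makes the whole matrix `P` triangular.
    let f : Col σ → ℕ ×ₗ ℕ := fun c => toLex ((Fintype.equivFin ι c.1 : ℕ), (c.2 : ℕ))
    have hf : Function.Injective f := by
      rintro ⟨j, k⟩ ⟨j', k'⟩ h
      have h' := Prod.ext_iff.1 (toLex.injective h)
      obtain rfl : j = j' := (Fintype.equivFin ι).injective (Fin.ext h'.1)
      obtain rfl : k = k' := Fin.ext h'.2
      rfl
    let : LinearOrder (Col σ) := LinearOrder.lift' f hf
    have hPne : ∀ c c' : Col σ, c.1 ≠ c'.1 → P c c' = 0 := by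
      intro c c' hj
      have : hermitePoly σ x c = (X - C (x c'.1)) ^ mult σ c'.1 * ((X - C (x c.1)) ^ (c.2 : ℕ) *
          ∏ l ∈ (Finset.univ.erase c.1).erase c'.1, (X - C (x l)) ^ mult σ l) := by
        rw [hermitePoly, ← Finset.mul_prod_erase (Finset.univ.erase c.1) _
          (Finset.mem_erase.2 ⟨Ne.symm hj, Finset.mem_univ _⟩)]
        ring
      rw [hP, this, eval_hasseDeriv_X_sub_C_pow_mul, if_neg (not_le.2 c'.2.2)]
    rw [Matrix.det_of_isUpperTriangular]
    · refine Submonoid.prod_mem _ fun c _ => ?_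
      rw [hP, hermitePoly, eval_hasseDeriv_X_sub_C_pow_mul, if_pos le_rfl, Nat.sub_self,
        taylor_coeff_zero, eval_prod]
      refine Submonoid.prod_mem _ fun l hl => ?_
      rw [eval_pow]
      rw [eval_sub, eval_X, eval_C]
      exact Submonoid.pow_mem _ (sub_mem_diffSubmonoid x (Finset.ne_of_mem_erase hl).symm) _
    · intro c c' hc
      by_cases hj : c.1 = c'.1
      · have hlt : toLex ((Fintype.equivFin ι c'.1 : ℕ), (c'.2 : ℕ)) <
            toLex ((Fintype.equivFin ι c.1 : ℕ), (c.2 : ℕ)) := hc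
        have hk : (c'.2 : ℕ) < c.2 := by
          simpa [Prod.Lex.toLex_lt_toLex, hj] using hlt
        rw [hP, hermitePoly, show x c'.1 = x c.1 by rw [hj], eval_hasseDeriv_X_sub_C_pow_mul, if_neg (not_le.2 hk)]
      · exact hPne c c' hj
  let M' : Matrix (Col σ) (Col σ) A := (confluent σ x).submatrix ε id
  let H' : Matrix (Col σ) (Col σ) A := H.submatrix id ε
  have hHM : H' * M' = P := by
    simp only [H', M']
    rw [Matrix.submatrix_mul_equiv]
    rfl
  -- From `H' M' = P`, `det H' · adj M'` times `M'`, in either order, is `det H' · det M' = det P`.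
  -- The adjugate provides the two-sided identity, which `H` alone does not.
  let W : Matrix (Col σ) (Fin n) A := (H'.det • M'.adjugate).submatrix id ε.symm
  have hd : H'.det * M'.det = P.det := by rw [← Matrix.det_mul, hHM]
  have hM : confluent σ x = M'.submatrix ε.symm id := by
    simp [M']
  refine ⟨W, P.det, hdet, ?_, ?_⟩
  · rw [hM, Matrix.submatrix_mul_equiv, Matrix.smul_mul, Matrix.adjugate_mul, smul_smul, hd]
    rfl
  · rw [hM, ← Matrix.submatrix_mul _ _ _ id _ Function.bijective_id, Matrix.mul_smul,
      Matrix.mul_adjugate, smul_smul, hd]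
    ext i j
    simp [Matrix.one_apply]

end FactoredCauchy

/-! ### The generators as elements of a localized commutative ring -/

namespace FactoredCauchy

variable {X : Type*} [NormedAddCommGroup X] [NormedSpace ℝ X] {ι : Type*}

/-- Resolvents `R j = (l j - B j)⁻¹` of the generators of a commuting family of semigroups. -/
structure IsResolventFamily (S : ι → C0Semigroup X) (B : ι → X →ₗ.[ℝ] X) (l : ι → ℝ)
    (R : ι → X →L[ℝ] X) : Prop where
  commute_toFun : ∀ j k s t, Commute ((S j).toFun s) ((S k).toFun t)
  commute_of : ∀ j (C : X →L[ℝ] X), (∀ t, Commute C ((S j).toFun t)) → Commute C (R j)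
  act_iff : ∀ j x x', R j (l j • x - x') = x ↔ x ∈ (B j).domain ∧ act (B j) x = x'
  hasDeriv : ∀ j x (t : ℝ), 0 ≤ t →
    HasDerivWithinAt (fun t : ℝ => (S j).toFun t.toNNReal (R j x))
      ((S j).toFun t.toNNReal (l j • R j x - x)) (Ici 0) t

theorem exists_isResolventFamily [CompleteSpace X] (S : ι → C0Semigroup X)
    (B : ι → X →ₗ.[ℝ] X) (hB : ∀ j, B j = (S j).generator)
    (hA0 : ∀ j k : ι, ∀ s t : ℝ≥0,
      ((S j).toFun t).comp ((S k).toFun s) = ((S k).toFun s).comp ((S j).toFun t)) :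
    ∃ l R, IsResolventFamily S B l R := by
  choose l R h1 h2 h3 using fun j => (S j).exists_resolvent
  refine ⟨l, R, fun j k s t => hA0 j k t s, h1, fun j => ?_, h3⟩
  rw [hB]
  exact h2 j

namespace IsResolventFamily

variable {S : ι → C0Semigroup X} {B : ι → X →ₗ.[ℝ] X} {l : ι → ℝ} {R : ι → X →L[ℝ] X}
  (h : IsResolventFamily S B l R)
include h

theorem commute_resolvent_toFun (j k : ι) (t : ℝ≥0) : Commute (R j) ((S k).toFun t) :=
  (h.commute_of j _ fun s => h.commute_toFun k j t s).symm

theorem commute_resolvent (j k : ι) : Commute (R j) (R k) :=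
  h.commute_of k _ fun s => h.commute_resolvent_toFun j k s

theorem resolvent_mem (j : ι) (w : X) : R j w ∈ (B j).domain :=
  ((h.act_iff j (R j w) (l j • R j w - w)).1 (by rw [sub_sub_cancel])).1

theorem act_resolvent (j : ι) (w : X) : act (B j) (R j w) = l j • R j w - w :=
  ((h.act_iff j (R j w) (l j • R j w - w)).1 (by rw [sub_sub_cancel])).2

theorem resolvent_injective (j : ι) : Function.Injective (R j) := by
  rw [injective_iff_map_eq_zero]
  intro w hw
  have h1 := h.act_resolvent j w
  have h0 : act (B j) (0 : X) = 0 := by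
    rw [act, dif_pos (B j).domain.zero_mem]
    exact (B j).map_zero
  rw [hw, h0, smul_zero, zero_sub] at h1
  simpa using h1.symm

theorem resolvent_apply {j : ι} {x : X} (hx : x ∈ (B j).domain) :
    R j (l j • x - act (B j) x) = x :=
  (h.act_iff j x _).2 ⟨hx, rfl⟩

end IsResolventFamily

/-- A commutative ring acting on an extension `Y` of `X`, with elements that act like the operators
`B j` wherever these are defined. -/
structure Model (B : ι → X →ₗ.[ℝ] X) (K Y : Type*) [CommRing K] [AddCommGroup Y] [Module K Y] where
  e : X →+ Y
  b : ι → K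
  inj : Function.Injective e
  act_iff : ∀ j x x', b j • e x = e x' ↔ x ∈ (B j).domain ∧ act (B j) x = x'
  sub_inj : ∀ j k, j ≠ k → ∀ y : Y, b j • y = b k • y → y = 0

/-- The bounded operators that commute with the semigroups and with everything that
commutes with the semigroups. -/
abbrev bicommutant (S : ι → C0Semigroup X) : Type _ :=
  Subring.center (Subring.centralizer {C : X →L[ℝ] X | ∃ i t, C = (S i).toFun t})

/-- The elements of the bicommutant that are injective on `X`. -/
def injectives (S : ι → C0Semigroup X) : Submonoid (bicommutant S) where
  carrier := {a | ∀ x : X, a • x = 0 → x = 0}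
  one_mem' := fun x hx => by simpa using hx
  mul_mem' := fun {a b} ha hb x hx => hb x (ha _ (by rwa [mul_smul] at hx))

theorem injectives_cancel {S : ι → C0Semigroup X} (u : injectives S) {x y : X}
    (h : u • x = u • y) : x = y := by
  rw [← sub_eq_zero]
  refine u.2 _ ?_
  rw [smul_sub, sub_eq_zero]
  exact h

theorem exists_bicommutant {S : ι → C0Semigroup X} {C : X →L[ℝ] X}
    (h1 : ∀ i t, Commute C ((S i).toFun t))
    (h2 : ∀ D : X →L[ℝ] X, (∀ i t, Commute D ((S i).toFun t)) → Commute C D) :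
    ∃ a : bicommutant S, ∀ x : X, a • x = C x := by
  have hC : C ∈ Subring.centralizer {C : X →L[ℝ] X | ∃ i t, C = (S i).toFun t} := by
    rw [Subring.mem_centralizer_iff]
    rintro _ ⟨i, t, rfl⟩
    exact (h1 i t).symm.eq
  refine ⟨⟨⟨C, hC⟩, ?_⟩, fun x => rfl⟩
  rw [Subring.mem_center_iff]
  rintro ⟨D, hD⟩
  apply Subtype.ext
  refine ((h2 D fun i t => ?_).eq).symm
  exact ((Subring.mem_centralizer_iff.1 hD) _ ⟨i, t, rfl⟩).symm

/-- Clearing the denominator, `b j • x = x'` reads `l j R j x - x = R j x'`, which is the resolvent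
description of `B j x = x'`. Denominators cancel because they are injective on `X`. -/
theorem exists_model {S : ι → C0Semigroup X} {B : ι → X →ₗ.[ℝ] X} {l : ι → ℝ}
    {R : ι → X →L[ℝ] X} (h : IsResolventFamily S B l R)
    (hA1 : ∀ j k : ι, j ≠ k → Function.Injective (B j - B k)) :
    Nonempty (Model B (Localization (injectives S)) (LocalizedModule (injectives S) X)) := by
  have hR : ∀ j, ∃ a : bicommutant S, ∀ x : X, a • x = R j x := fun j =>
    exists_bicommutant (h.commute_resolvent_toFun j) fun D hD => (h.commute_of j D (hD j)).symm
  choose a ha using hR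
  have hT : ∀ j, ∃ a : bicommutant S, ∀ x : X, a • x = l j • R j x - x := fun j =>
    exists_bicommutant (C := l j • R j - 1)
      (fun i t => ((h.commute_resolvent_toFun j i t).smul_left _).sub_left (Commute.one_left _))
      fun D hD => ((h.commute_of j D (hD j)).symm.smul_left _).sub_left (Commute.one_left _)
  choose c hc using hT
  have hinj : ∀ j, a j ∈ injectives S := fun j x hx => by
    rw [ha] at hx
    exact (map_eq_zero_iff _ (h.resolvent_injective j)).1 hx
  refine ⟨⟨(LocalizedModule.mkLinearMap (injectives S) X).toAddMonoidHom,
    fun j => Localization.mk (c j) ⟨a j, hinj j⟩, ?_, fun j x x' => ?_, fun j k hjk y hy => ?_⟩⟩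
  · intro x y hxy
    obtain ⟨u, hu⟩ := LocalizedModule.mk_eq.1 (hxy : LocalizedModule.mk x 1 = LocalizedModule.mk y 1)
    rw [one_smul, one_smul] at hu
    exact injectives_cancel u hu
  · change Localization.mk (c j) ⟨a j, hinj j⟩ • LocalizedModule.mk x 1 = LocalizedModule.mk x' 1 ↔ _
    rw [LocalizedModule.mk_smul_mk, LocalizedModule.mk_eq, ← h.act_iff]
    have key : (c j • x = a j • x') ↔ R j (l j • x - x') = x := by
      rw [hc, ha, map_sub, map_smul, sub_eq_iff_eq_add, sub_eq_iff_eq_add, add_comm]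
    rw [← key]
    constructor
    · rintro ⟨u, hu⟩
      rw [one_smul, mul_one] at hu
      exact injectives_cancel u hu
    · intro hu
      refine ⟨1, ?_⟩
      rw [one_smul, one_smul, one_smul, mul_one]
      exact hu
  · induction y using LocalizedModule.induction_on with
    | h x s =>
      rw [LocalizedModule.mk_smul_mk, LocalizedModule.mk_smul_mk, LocalizedModule.mk_eq] at hy
      obtain ⟨u, hu⟩ := hy
      -- For a numerator `x`, cross-multiplication turns `b j y = b k y` into `R k (l j R j - 1) x =
      -- R j (l k R k - 1) x`, that is, `(B j - B k) R j R k x = 0`. Injectivity of the difference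
      -- and of the resolvents gives `x = 0`.
      have h1 := injectives_cancel u hu
      rw [mul_comm, mul_comm (⟨a j, _⟩ : injectives S), mul_smul, mul_smul] at h1
      have h2 : a k • c j • x = a j • c k • x := injectives_cancel s h1
      rw [ha, ha, hc, hc] at h2
      have hcomm : R j (R k x) = R k (R j x) := DFunLike.congr_fun (h.commute_resolvent j k).eq x
      have hj : R j (R k x) ∈ (B j).domain := h.resolvent_mem _ _
      have hk : R j (R k x) ∈ (B k).domain := hcomm ▸ h.resolvent_mem _ _
      have e1 : B j ⟨_, hj⟩ = l j • R j (R k x) - R k x := by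
        have := h.act_resolvent j (R k x)
        rwa [act, dif_pos hj] at this
      have e2 : B k ⟨_, hk⟩ = l k • R j (R k x) - R j x := by
        have := h.act_resolvent k (R j x)
        rw [← hcomm, act, dif_pos hk] at this
        exact this
      have h3 : (B j - B k) ⟨R j (R k x), hj, hk⟩ = 0 := by
        rw [LinearPMap.sub_apply]
        refine (congrArg₂ (· - ·) e1 e2).trans ?_
        simp only [map_sub, map_smul] at h2
        rw [← hcomm] at h2
        rw [sub_eq_zero]
        exact h2
      have h4 := hA1 j k hjk (h3.trans (B j - B k).map_zero.symm)
      have h5 : R j (R k x) = 0 := congrArg Subtype.val h4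
      rw [map_eq_zero_iff _ (h.resolvent_injective j),
        map_eq_zero_iff _ (h.resolvent_injective k)] at h5
      rw [h5, LocalizedModule.zero_mk]

end FactoredCauchy

/-! ### Smooth paths; injectivity and range of the operator matrix -/

namespace FactoredCauchy

variable {X : Type*} [NormedAddCommGroup X] [NormedSpace ℝ X] {ι : Type*}

theorem act_of_mem {A : X →ₗ.[ℝ] X} {x : X} (hx : x ∈ A.domain) : act A x = A ⟨x, hx⟩ :=
  dif_pos hx

theorem act_add {A : X →ₗ.[ℝ] X} {x y : X} (hx : x ∈ A.domain) (hy : y ∈ A.domain) :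
    act A (x + y) = act A x + act A y := by
  rw [act_of_mem hx, act_of_mem hy, act_of_mem (A.domain.add_mem hx hy), ← A.map_add]
  rfl

theorem act_smul {A : X →ₗ.[ℝ] X} {x : X} (c : ℝ) (hx : x ∈ A.domain) :
    act A (c • x) = c • act A x := by
  rw [act_of_mem hx, act_of_mem (A.domain.smul_mem c hx), ← A.map_smul]
  rfl

theorem act_zero (A : X →ₗ.[ℝ] X) : act A (0 : X) = 0 := by
  rw [act_of_mem A.domain.zero_mem]
  exact A.map_zero

theorem act_sub_operator {A A' : X →ₗ.[ℝ] X} {x : X} (hx : x ∈ A.domain) (hx' : x ∈ A'.domain) :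
    act (A - A') x = act A x - act A' x := by
  have h : x ∈ (A - A').domain := ⟨hx, hx'⟩
  rw [act_of_mem h, act_of_mem hx, act_of_mem hx', LinearPMap.sub_apply]

section SmoothPath

variable {B : ι → X →ₗ.[ℝ] X} {T : ℝ}

theorem SmoothPath.continuousOn {N : ℕ} {g : ℝ → X} (h : SmoothPath B T N g) :
    ContinuousOn g (Icc 0 T) := by
  cases N with
  | zero => exact h
  | succ N => exact h.1

theorem SmoothPath.congr {N : ℕ} {g g' : ℝ → X} (h : SmoothPath B T N g)
    (e : ∀ t ∈ Icc 0 T, g' t = g t) : SmoothPath B T N g' := by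
  induction N generalizing g g' with
  | zero => exact ContinuousOn.congr h e
  | succ N ih =>
    refine ⟨h.1.congr e, fun j => ⟨fun t ht => ?_, ?_⟩⟩
    · rw [e t ht]; exact (h.2 j).1 t ht
    · exact ih (h.2 j).2 fun t ht => by rw [e t ht]

theorem SmoothPath.add {N : ℕ} {g g' : ℝ → X} (h : SmoothPath B T N g)
    (h' : SmoothPath B T N g') : SmoothPath B T N (fun t => g t + g' t) := by
  induction N generalizing g g' with
  | zero => exact ContinuousOn.add h h'
  | succ N ih =>
    refine ⟨h.1.add h'.1, fun j => ⟨fun t ht => ?_, ?_⟩⟩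
    · exact (B j).domain.add_mem ((h.2 j).1 t ht) ((h'.2 j).1 t ht)
    · exact (ih (h.2 j).2 (h'.2 j).2).congr fun t ht =>
        act_add ((h.2 j).1 t ht) ((h'.2 j).1 t ht)

theorem SmoothPath.smul {N : ℕ} {g : ℝ → X} (h : SmoothPath B T N g) (c : ℝ) :
    SmoothPath B T N (fun t => c • g t) := by
  induction N generalizing g with
  | zero => exact ContinuousOn.const_smul h c
  | succ N ih =>
    refine ⟨h.1.const_smul c, fun j => ⟨fun t ht => ?_, ?_⟩⟩
    · exact (B j).domain.smul_mem _ ((h.2 j).1 t ht)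
    · exact (ih (h.2 j).2).congr fun t ht => act_smul c ((h.2 j).1 t ht)

theorem SmoothPath.sub {N : ℕ} {g g' : ℝ → X} (h : SmoothPath B T N g)
    (h' : SmoothPath B T N g') : SmoothPath B T N (fun t => g t - g' t) :=
  (h.add (h'.smul (-1))).congr fun t _ => by simp [sub_eq_add_neg]

theorem smoothPath_zero (N : ℕ) : SmoothPath B T N (fun _ => 0) := by
  induction N with
  | zero => exact continuousOn_const
  | succ N ih =>
    refine ⟨continuousOn_const, fun j => ⟨fun t _ => (B j).domain.zero_mem, ?_⟩⟩
    exact ih.congr fun t _ => act_zero _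

theorem SmoothPath.sum {α : Type*} (s : Finset α) {N : ℕ} {g : α → ℝ → X}
    (h : ∀ a ∈ s, SmoothPath B T N (g a)) : SmoothPath B T N (fun t => ∑ a ∈ s, g a t) := by
  classical
  induction s using Finset.induction_on with
  | empty => simpa using smoothPath_zero N
  | insert a s ha ih =>
    simp only [Finset.sum_insert ha]
    exact (h a (Finset.mem_insert_self _ _)).add
      (ih fun a' ha' => h a' (Finset.mem_insert_of_mem ha'))

theorem SmoothPath.of_succ {N : ℕ} {g : ℝ → X} (h : SmoothPath B T (N + 1) g) :
    SmoothPath B T N g := by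
  induction N generalizing g with
  | zero => exact h.1
  | succ N ih => exact ⟨h.1, fun j => ⟨(h.2 j).1, ih (h.2 j).2⟩⟩

theorem SmoothPath.mono {N M : ℕ} {g : ℝ → X} (h : SmoothPath B T N g) (hM : M ≤ N) :
    SmoothPath B T M g := by
  induction hM with
  | refl => exact h
  | step _ ih => exact ih h.of_succ

theorem SmoothPath.mem_smooth {N : ℕ} {g : ℝ → X} (h : SmoothPath B T N g) {t : ℝ}
    (ht : t ∈ Icc 0 T) : g t ∈ smooth B N := by
  induction N generalizing g with
  | zero => exact mem_univ _
  | succ N ih => exact fun j => ⟨(h.2 j).1 t ht, ih (h.2 j).2⟩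

theorem smoothPath_const {N : ℕ} {x : X} (h : x ∈ smooth B N) : SmoothPath B T N (fun _ => x) := by
  induction N generalizing x with
  | zero => exact continuousOn_const
  | succ N ih => exact ⟨continuousOn_const, fun j => ⟨fun _ _ => (h j).1, ih (h j).2⟩⟩

theorem iterate_act_mem {N p : ℕ} {x : X} (hx : x ∈ smooth B N) (hp : p < N) (j : ι) :
    (act (B j))^[p] x ∈ (B j).domain := by
  induction p generalizing N x with
  | zero =>
    cases N with
    | zero => omega
    | succ N => exact (hx j).1
  | succ p ih =>
    cases N with
    | zero => omega
    | succ N => exact ih (hx j).2 (by omega)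

variable [DecidableEq ι] {n : ℕ}

theorem inDom_of_smooth {σ : Fin n → ι} {y : X} (hy : y ∈ smooth B n) (c : Col σ) :
    InDom B σ c y := fun p hp => iterate_act_mem hy (by omega) _

end SmoothPath

namespace Model

variable {B : ι → X →ₗ.[ℝ] X} {T : ℝ} {K Y : Type*} [CommRing K] [AddCommGroup Y] [Module K Y]
  (m : Model B K Y)

theorem e_act {j : ι} {x : X} (hx : x ∈ (B j).domain) : m.e (act (B j) x) = m.b j • m.e x :=
  ((m.act_iff j x _).2 ⟨hx, rfl⟩).symm

theorem e_iterate_act {j : ι} {x : X} {q : ℕ} (h : ∀ p < q, (act (B j))^[p] x ∈ (B j).domain) :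
    m.e ((act (B j))^[q] x) = m.b j ^ q • m.e x := by
  induction q with
  | zero => simp
  | succ q ih =>
    rw [Function.iterate_succ_apply', m.e_act (h q (by omega)), ih fun p hp => h p (by omega),
      smul_smul, pow_succ']

theorem e_natCast_smul (k : ℕ) (x : X) : m.e ((k : ℝ) • x) = (k : K) • m.e x := by
  rw [Nat.cast_smul_eq_nsmul, map_nsmul, Nat.cast_smul_eq_nsmul]

theorem e_diffProd {L : List (ι × ι)} {N : ℕ} {x : X} (hx : x ∈ smooth B N) (hL : L.length ≤ N) :
    m.e (diffProd B L x) = (L.map fun q => m.b q.1 - m.b q.2).prod • m.e x := by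
  -- A vector is treated as a constant path on the degenerate interval `[0,0]`, so that the closure
  -- properties of `SmoothPath` apply; `M` is the smoothness left after the factors of `L`.
  suffices H : ∀ M, SmoothPath B 0 (M + L.length) (fun _ => x) →
      SmoothPath B 0 M (fun _ => diffProd B L x) ∧
        m.e (diffProd B L x) = (L.map fun q => m.b q.1 - m.b q.2).prod • m.e x from
    (H (N - L.length) (by rw [Nat.sub_add_cancel hL]; exact smoothPath_const hx)).2
  clear hL
  induction L with
  | nil => exact fun M h => ⟨by simpa [diffProd] using h, by simp [diffProd]⟩
  | cons q L ih =>
    intro M h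
    obtain ⟨h1, h2⟩ := ih (M + 1) (by rw [List.length_cons] at h; convert h using 1; omega)
    have hj := (h1.2 q.1).1 0 (by simp)
    have hk := (h1.2 q.2).1 0 (by simp)
    have h3 : diffProd B (q :: L) x = act (B q.1) (diffProd B L x) - act (B q.2) (diffProd B L x) :=
      act_sub_operator hj hk
    rw [h3]
    refine ⟨(h1.2 q.1).2.sub (h1.2 q.2).2, ?_⟩
    rw [map_sub, m.e_act hj, m.e_act hk, h2, List.map_cons, List.prod_cons, mul_smul, sub_smul]

/-- Polynomials in the `B j` map paths of high smoothness to smooth paths. -/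
theorem exists_smoothPath_aeval (p : MvPolynomial ι ℤ) : ∃ d : ℕ, ∀ (N : ℕ) (g : ℝ → X),
    SmoothPath B T (N + d) g → ∃ h : ℝ → X, SmoothPath B T N h ∧
      ∀ t ∈ Icc 0 T, m.e (h t) = MvPolynomial.aeval m.b p • m.e (g t) := by
  induction p using MvPolynomial.induction_on with
  | C a =>
    refine ⟨0, fun N g hg => ⟨fun t => (a : ℝ) • g t, hg.smul _, fun t _ => ?_⟩⟩
    change m.e ((a : ℝ) • g t) = _
    rw [Int.cast_smul_eq_zsmul, map_zsmul, MvPolynomial.aeval_C]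
    simp [Int.cast_smul_eq_zsmul]
  | add p q hp hq =>
    obtain ⟨d, hd⟩ := hp
    obtain ⟨d', hd'⟩ := hq
    refine ⟨d + d', fun N g hg => ?_⟩
    obtain ⟨h, h1, h2⟩ := hd N g (hg.mono (by omega))
    obtain ⟨h', h1', h2'⟩ := hd' N g (hg.mono (by omega))
    refine ⟨_, h1.add h1', fun t ht => ?_⟩
    rw [_root_.map_add, h2 t ht, h2' t ht, _root_.map_add, add_smul]
  | mul_X p j hp =>
    obtain ⟨d, hd⟩ := hp
    refine ⟨d + 1, fun N g hg => ?_⟩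
    obtain ⟨h, h1, h2⟩ := hd N _ (hg.2 j).2
    refine ⟨h, h1, fun t ht => ?_⟩
    rw [h2 t ht, m.e_act ((hg.2 j).1 t ht), map_mul, MvPolynomial.aeval_X, mul_smul]

theorem smul_eq_zero_of_mem_diffSubmonoid {a : K} (ha : a ∈ diffSubmonoid m.b) {y : Y}
    (hy : a • y = 0) : y = 0 := by
  induction ha using Submonoid.closure_induction generalizing y with
  | mem a h =>
    obtain ⟨q, hq, rfl⟩ := h
    rw [sub_smul, sub_eq_zero] at hy
    exact m.sub_inj _ _ hq y hy
  | one => simpa using hy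
  | mul a b _ _ ha hb =>
    rw [mul_smul] at hy
    exact hb (ha hy)

variable [Fintype ι] [DecidableEq ι] {n : ℕ} {σ : Fin n → ι}

theorem e_mulM {y : Col σ → X} (hy : ∀ c, InDom B σ c (y c)) (r : Fin n) :
    m.e (mulM B σ y r) = ∑ c, confluent σ m.b r c • m.e (y c) := by
  rw [mulM, map_sum]
  refine Finset.sum_congr rfl fun c _ => ?_
  rw [e_natCast_smul, confluent, mul_smul]
  -- Here truncated subtraction would leave a spurious zeroth power, but the binomial coefficient is
  -- zero.
  by_cases h : (r : ℕ) < c.2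
  · rw [Nat.choose_eq_zero_of_lt h]
    simp
  · rw [m.e_iterate_act fun p hp => hy c p (by omega)]

include m in
-- Multiplying by `W` from the left shows that `M_n y` determines `d • e (y c)`, and products of
-- differences act injectively.
theorem mulM_injective {y y' : Col σ → X} (hy : ∀ c, InDom B σ c (y c))
    (hy' : ∀ c, InDom B σ c (y' c)) (h : mulM B σ y = mulM B σ y') : y = y' := by
  obtain ⟨W, d, hd, hWM, -⟩ := exists_confluent_inverse σ m.b
  funext c
  apply m.inj
  rw [← sub_eq_zero]
  refine m.smul_eq_zero_of_mem_diffSubmonoid hd ?_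
  have key : ∀ z : Col σ → X, (∀ c, InDom B σ c (z c)) →
      d • m.e (z c) = ∑ r, W c r • m.e (mulM B σ z r) := by
    intro z hz
    simp only [m.e_mulM hz, Finset.smul_sum, smul_smul]
    rw [Finset.sum_comm]
    simp only [← Finset.sum_smul, ← Matrix.mul_apply, hWM, Matrix.smul_apply, Matrix.one_apply]
    simp
  rw [smul_sub, key y hy, key y' hy', h, sub_self]

omit [Fintype ι] in
theorem aeval_confluent (r : Fin n) (c : Col σ) :
    MvPolynomial.aeval m.b (confluent σ (MvPolynomial.X : ι → MvPolynomial ι ℤ) r c) =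
      confluent σ m.b r c := by
  simp [confluent]

include m in
-- If `x = Δ v`, then `y = W v` solves `M_n y = x`, because `M_n W = d` and `d` acts as `Δ`. Vectors
-- and right-hand sides are handled together, vectors being constant paths.
theorem exists_range (hT : 0 ≤ T) :
    ∃ L : List (ι × ι), (∀ q ∈ L, q.1 ≠ q.2) ∧ ∃ N : ℕ,
      (∀ x : Fin n → X, (∀ r, ∃ v ∈ smooth B N, diffProd B L v = x r) →
        ∃ y : Col σ → X, (∀ c, y c ∈ smooth B n) ∧ mulM B σ y = x) ∧
      (∀ f : ℝ → X, (∃ g : ℝ → X, SmoothPath B T N g ∧ ∀ t ∈ Icc 0 T, diffProd B L (g t) = f t) →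
        ∃ z : Col σ → ℝ → X, (∀ c, SmoothPath B T n (z c)) ∧
          ∀ t ∈ Icc 0 T, mulM B σ (fun c => z c t) = lastVec n (f t)) := by
  -- The inverse is taken over `ℤ[X_j]` and not over `K`: a general element of `K` does not map
  -- smooth vectors into `X`, a polynomial in the `B j` does.
  obtain ⟨W, d, hd, -, hMW⟩ :=
    exists_confluent_inverse σ (MvPolynomial.X : ι → MvPolynomial ι ℤ)
  obtain ⟨L, hL, hLd⟩ := exists_list_of_mem_diffSubmonoid hd
  have hLd' : (L.map fun q => m.b q.1 - m.b q.2).prod = MvPolynomial.aeval m.b d := by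
    rw [← hLd, map_list_prod, List.map_map]
    simp [Function.comp_def]
  choose D hD using fun c r => m.exists_smoothPath_aeval (T := T) (W c r)
  let D' := ∑ c, ∑ r, D c r
  have hDle : ∀ c r, D c r ≤ D' := fun c r =>
    (Finset.single_le_sum (f := fun r => D c r) (fun _ _ => Nat.zero_le _)
      (Finset.mem_univ r)).trans
    (Finset.single_le_sum (f := fun c => ∑ r, D c r) (fun _ _ => Nat.zero_le _)
      (Finset.mem_univ c))
  have hMWb : ∀ r r', ∑ c, confluent σ m.b r c * MvPolynomial.aeval m.b (W c r') =
      if r = r' then MvPolynomial.aeval m.b d else 0 := by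
    intro r r'
    have := congrArg (MvPolynomial.aeval m.b) (congrFun (congrFun hMW r) r')
    rw [Matrix.mul_apply, map_sum, Matrix.smul_apply, Matrix.one_apply] at this
    simp only [map_mul, aeval_confluent] at this
    rw [this]
    split_ifs <;> simp
  -- Of the order of smoothness, `D'` pays for the entries of `W`, `n` is what `z` has to retain,
  -- and `L.length` suffices for evaluating `Δ`.
  have key : ∀ g : Fin n → ℝ → X, (∀ r, SmoothPath B T (n + D' + L.length) (g r)) →
      ∃ z : Col σ → ℝ → X, (∀ c, SmoothPath B T n (z c)) ∧ ∀ t ∈ Icc 0 T,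
        mulM B σ (fun c => z c t) = fun r => diffProd B L (g r t) := by
    intro g hg
    choose h h1 h2 using fun c r => hD c r n (g r) ((hg r).mono (by have := hDle c r; omega))
    refine ⟨fun c t => ∑ r, h c r t, fun c => SmoothPath.sum _ fun r _ => h1 c r, fun t ht => ?_⟩
    funext r
    apply m.inj
    rw [m.e_mulM fun c => inDom_of_smooth ((SmoothPath.sum _ fun r _ => h1 c r).mem_smooth ht) c,
      m.e_diffProd ((hg r).mem_smooth ht) (by omega), hLd']
    simp only [map_sum, h2 _ _ t ht, Finset.smul_sum, smul_smul]
    rw [Finset.sum_comm]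
    simp only [← Finset.sum_smul, hMWb]
    simp
  have h0 : (0 : ℝ) ∈ Icc 0 T := ⟨le_rfl, hT⟩
  refine ⟨L, hL, n + D' + L.length, fun x hx => ?_, fun f ⟨g, hg, hgf⟩ => ?_⟩
  · choose v hv hvx using hx
    obtain ⟨z, hz, hzx⟩ := key (fun r _ => v r) fun r => smoothPath_const (hv r)
    refine ⟨fun c => z c 0, fun c => (hz c).mem_smooth h0, ?_⟩
    rw [hzx 0 h0]
    exact funext hvx
  · obtain ⟨z, hz, hzx⟩ := key (fun r t => if (r : ℕ) + 1 = n then g t else 0) fun r => by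
      by_cases hr : (r : ℕ) + 1 = n
      · simpa only [if_pos hr] using hg
      · simpa only [if_neg hr] using smoothPath_zero _
    refine ⟨z, hz, fun t ht => ?_⟩
    rw [hzx t ht]
    funext r
    rw [lastVec]
    by_cases hr : (r : ℕ) + 1 = n
    · rw [if_pos hr, if_pos hr, hgf t ht]
    · rw [if_neg hr, if_neg hr]
      apply m.inj
      rw [m.e_diffProd (smoothPath_zero (B := B) (T := T) L.length |>.mem_smooth h0) le_rfl,
        map_zero, smul_zero]

end Model

end FactoredCauchy

/-! ### Convolutions with a semigroup and their derivatives -/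

section Leibniz

variable {X : Type*} [NormedAddCommGroup X] [NormedSpace ℝ X]

theorem integral_triangle_swap {H : ℝ → ℝ → X} (hH : Continuous (Function.uncurry H)) {t : ℝ}
    (ht : 0 ≤ t) : ∫ s in (0 : ℝ)..t, ∫ τ in s..t, H τ s =
      ∫ τ in (0 : ℝ)..t, ∫ s in (0 : ℝ)..τ, H τ s := by
  let F : ℝ → ℝ → X := fun s τ => {p : ℝ × ℝ | p.1 < p.2}.indicator (fun p => H p.2 p.1) (s, τ)
  have hF : Integrable (Function.uncurry F)
      ((volume.restrict (Ioc 0 t)).prod (volume.restrict (Ioc 0 t))) := by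
    refine Integrable.indicator ?_ (measurableSet_lt measurable_fst measurable_snd)
    rw [Measure.prod_restrict]
    have hc : Continuous fun p : ℝ × ℝ => H p.2 p.1 := hH.comp continuous_swap
    exact (hc.continuousOn.integrableOn_compact (isCompact_Icc.prod isCompact_Icc)).mono_set
      (prod_mono Ioc_subset_Icc_self Ioc_subset_Icc_self)
  have h1 : ∫ s in (0 : ℝ)..t, ∫ τ in s..t, H τ s = ∫ s in Ioc 0 t, ∫ τ in Ioc 0 t, F s τ := by
    rw [intervalIntegral.integral_of_le ht]
    refine setIntegral_congr_fun measurableSet_Ioc fun s hs => ?_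
    have : ∀ τ, F s τ = (Ioi s).indicator (fun τ => H τ s) τ := fun τ => rfl
    simp only [this]
    rw [setIntegral_indicator measurableSet_Ioi, Ioc_inter_Ioi, max_eq_right hs.1.le,
      intervalIntegral.integral_of_le hs.2]
  have h2 : ∫ τ in (0 : ℝ)..t, ∫ s in (0 : ℝ)..τ, H τ s =
      ∫ τ in Ioc 0 t, ∫ s in Ioc 0 t, F s τ := by
    rw [intervalIntegral.integral_of_le ht]
    refine setIntegral_congr_fun measurableSet_Ioc fun τ hτ => ?_
    have : ∀ s, F s τ = (Iio τ).indicator (fun s => H τ s) s := fun s => rfl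
    simp only [this]
    have e : Ioc 0 t ∩ Iio τ = Ioo 0 τ := by
      ext s
      simp only [mem_inter_iff, mem_Ioc, mem_Iio, mem_Ioo]
      exact ⟨fun h => ⟨h.1.1, h.2⟩, fun h => ⟨⟨h.1, h.2.le.trans hτ.2⟩, h.2⟩⟩
    rw [setIntegral_indicator measurableSet_Iio, e, ← integral_Ioc_eq_integral_Ioo,
      intervalIntegral.integral_of_le hτ.1.le]
  rw [h1, h2]
  exact integral_integral_swap hF

/-- Leibniz' rule for the kernel `φ s + ∫ τ in s..t, H τ s`. Exchanging the integrals over the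
triangle leaves `t` only as an upper limit, so the fundamental theorem of calculus suffices. -/
theorem hasDerivWithinAt_integral_triangle [CompleteSpace X] {φ : ℝ → X} {H : ℝ → ℝ → X}
    (hφ : Continuous φ)
    (hH : Continuous (Function.uncurry H)) {t : ℝ} (ht : 0 ≤ t) :
    HasDerivWithinAt (fun t => ∫ s in (0 : ℝ)..t, (φ s + ∫ τ in s..t, H τ s))
      (φ t + ∫ s in (0 : ℝ)..t, H t s) (Ici 0) t := by
  have hd : Continuous fun τ => ∫ s in (0 : ℝ)..τ, H τ s :=
    intervalIntegral.continuous_parametric_intervalIntegral_of_continuous hH continuous_id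
  have hc : Continuous fun τ => φ τ + ∫ s in (0 : ℝ)..τ, H τ s := hφ.add hd
  have hi : ∀ a : ℝ, Continuous fun s => ∫ τ in s..a, H τ s := by
    intro a
    have : Continuous fun s => -∫ τ in a..s, H τ s :=
      (intervalIntegral.continuous_parametric_intervalIntegral_of_continuous
        (f := fun s τ => H τ s) (hH.comp continuous_swap) continuous_id).neg
    exact this.congr fun s => (intervalIntegral.integral_symm _ _).symm
  have h1 : HasDerivWithinAt (fun t => ∫ τ in (0 : ℝ)..t, (φ τ + ∫ s in (0 : ℝ)..τ, H τ s))
      (φ t + ∫ s in (0 : ℝ)..t, H t s) (Ici 0) t :=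
    (hc.integral_hasStrictDerivAt 0 t).hasDerivAt.hasDerivWithinAt
  have h2 : ∀ a ∈ Ici (0 : ℝ), ∫ s in (0 : ℝ)..a, (φ s + ∫ τ in s..a, H τ s) =
      ∫ τ in (0 : ℝ)..a, (φ τ + ∫ s in (0 : ℝ)..τ, H τ s) := by
    intro a ha
    rw [intervalIntegral.integral_add (hφ.intervalIntegrable _ _) ((hi a).intervalIntegrable _ _),
      intervalIntegral.integral_add (hφ.intervalIntegrable _ _)
        (hd.intervalIntegrable _ _), integral_triangle_swap hH ha]
  exact h1.congr h2 (h2 t ht)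

end Leibniz

namespace C0Semigroup

variable {X : Type*} [NormedAddCommGroup X] [NormedSpace ℝ X] [CompleteSpace X]
  (S : C0Semigroup X) {T : ℝ}

omit [NormedSpace ℝ X] [CompleteSpace X] in
/-- The continuous extension of a path on `[0,T]` that is constant outside `[0,T]`. -/
def extendIcc {T : ℝ} (hT : 0 ≤ T) (z : ℝ → X) : ℝ → X := fun t => z (projIcc 0 T hT t)

omit [NormedAddCommGroup X] [NormedSpace ℝ X] [CompleteSpace X] in
theorem extendIcc_of_mem (hT : 0 ≤ T) (z : ℝ → X) {t : ℝ} (ht : t ∈ Icc 0 T) :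
    extendIcc hT z t = z t := by
  rw [extendIcc, projIcc_of_mem hT ht]

omit [NormedSpace ℝ X] [CompleteSpace X] in
theorem continuous_extendIcc (hT : 0 ≤ T) {z : ℝ → X} (hz : ContinuousOn z (Icc 0 T)) :
    Continuous (extendIcc hT z) :=
  hz.comp_continuous (continuous_subtype_val.comp continuous_projIcc) fun t =>
    (projIcc 0 T hT t).2

omit [CompleteSpace X] in
/-- The convolution of the operator-valued function `a(t) S(t)` with `z`. -/
def conv (S : C0Semigroup X) (a : ℝ → ℝ) (z : ℝ → X) (t : ℝ) : X :=
  ∫ s in (0 : ℝ)..t, a (t - s) • S.toFun (t - s).toNNReal (z s)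

omit [CompleteSpace X] in
theorem conv_zero_right (a : ℝ → ℝ) (z : ℝ → X) : S.conv a z 0 = 0 :=
  intervalIntegral.integral_same

omit [CompleteSpace X] in
theorem conv_congr {a : ℝ → ℝ} {z z' : ℝ → X} (h : ∀ t ∈ Icc 0 T, z t = z' t) {t : ℝ}
    (ht : t ∈ Icc 0 T) : S.conv a z t = S.conv a z' t := by
  refine intervalIntegral.integral_congr fun s hs => ?_
  rw [uIcc_of_le ht.1] at hs
  simp only [h s ⟨hs.1, hs.2.trans ht.2⟩]

theorem continuous_conv_integrand {a : ℝ → ℝ} (ha : Continuous a) {z : ℝ → X}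
    (hz : Continuous z) :
    Continuous fun p : ℝ × ℝ => a (p.1 - p.2) • S.toFun (p.1 - p.2).toNNReal (z p.2) :=
  (ha.comp (by fun_prop)).smul (S.continuous_apply (by fun_prop) (hz.comp continuous_snd))

theorem continuous_conv {a : ℝ → ℝ} (ha : Continuous a) {z : ℝ → X} (hz : Continuous z) :
    Continuous (S.conv a z) :=
  intervalIntegral.continuous_parametric_intervalIntegral_of_continuous
    (f := fun t s => a (t - s) • S.toFun (t - s).toNNReal (z s))
    (S.continuous_conv_integrand ha hz) continuous_id

theorem conv_intervalIntegrable {a : ℝ → ℝ} (ha : Continuous a) {z : ℝ → X}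
    (hz : ContinuousOn z (Icc 0 T)) {t : ℝ} (ht : t ∈ Icc 0 T) :
    IntervalIntegrable (fun s => a (t - s) • S.toFun (t - s).toNNReal (z s)) volume 0 t := by
  have hT : 0 ≤ T := ht.1.trans ht.2
  have hc : Continuous fun s => a (t - s) • S.toFun (t - s).toNNReal
      (extendIcc hT z s) :=
    (S.continuous_conv_integrand ha (continuous_extendIcc hT hz)).comp
      (by fun_prop : Continuous fun s : ℝ => (t, s))
  refine (hc.intervalIntegrable 0 t).congr fun s hs => ?_
  rw [uIoc_of_le ht.1] at hs
  simp only [extendIcc_of_mem hT _ (⟨hs.1.le, hs.2.trans ht.2⟩ : s ∈ Icc 0 T)]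

omit [CompleteSpace X] in
theorem conv_extend (hT : 0 ≤ T) (a : ℝ → ℝ) (z : ℝ → X) {t : ℝ} (ht : t ∈ Icc 0 T) :
    S.conv a (extendIcc hT z) t = S.conv a z t :=
  S.conv_congr (fun s hs => by rw [extendIcc_of_mem hT _ hs]) ht

theorem continuousOn_conv (hT : 0 ≤ T) {a : ℝ → ℝ} (ha : Continuous a) {z : ℝ → X}
    (hz : ContinuousOn z (Icc 0 T)) : ContinuousOn (S.conv a z) (Icc 0 T) :=
  (S.continuous_conv ha (continuous_extendIcc hT hz)).continuousOn.congr fun _ ht =>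
    (S.conv_extend hT a z ht).symm

theorem conv_add {a : ℝ → ℝ} (ha : Continuous a) {z z' : ℝ → X} (hz : ContinuousOn z (Icc 0 T))
    (hz' : ContinuousOn z' (Icc 0 T)) {t : ℝ} (ht : t ∈ Icc 0 T) :
    S.conv a (fun s => z s + z' s) t = S.conv a z t + S.conv a z' t := by
  rw [conv, conv, conv, ← intervalIntegral.integral_add (S.conv_intervalIntegrable ha hz ht)
    (S.conv_intervalIntegrable ha hz' ht)]
  simp only [_root_.map_add, smul_add]

theorem conv_sub {a : ℝ → ℝ} (ha : Continuous a) {z z' : ℝ → X} (hz : ContinuousOn z (Icc 0 T))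
    (hz' : ContinuousOn z' (Icc 0 T)) {t : ℝ} (ht : t ∈ Icc 0 T) :
    S.conv a (fun s => z s - z' s) t = S.conv a z t - S.conv a z' t := by
  rw [conv, conv, conv, ← intervalIntegral.integral_sub (S.conv_intervalIntegrable ha hz ht)
    (S.conv_intervalIntegrable ha hz' ht)]
  simp only [_root_.map_sub, smul_sub]

theorem conv_map {a : ℝ → ℝ} (ha : Continuous a) {z : ℝ → X} (hz : ContinuousOn z (Icc 0 T))
    {C : X →L[ℝ] X} (hC : ∀ t, Commute C (S.toFun t)) {t : ℝ} (ht : t ∈ Icc 0 T) :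
    S.conv a (fun s => C (z s)) t = C (S.conv a z t) := by
  rw [conv, conv, ← ContinuousLinearMap.intervalIntegral_comp_comm _
    (S.conv_intervalIntegrable ha hz ht)]
  refine intervalIntegral.integral_congr fun s _ => ?_
  have : ∀ x, C (S.toFun (t - s).toNNReal x) = S.toFun (t - s).toNNReal (C x) := fun x =>
    DFunLike.congr_fun (hC _).eq x
  simp only [map_smul, this]

/-- The derivative falls on the kernel `a(t-s) S(t-s)`; the path `w` plays the role of the generator
applied to `z`. -/
theorem hasDerivWithinAt_conv_of_domain (hT : 0 ≤ T) {a a' : ℝ → ℝ} (ha : Continuous a)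
    (ha' : Continuous a') (had : ∀ r, HasDerivAt a (a' r) r) {z w : ℝ → X}
    (hz : ContinuousOn z (Icc 0 T)) (hw : ContinuousOn w (Icc 0 T))
    (hzw : ∀ s ∈ Icc 0 T, ∀ r : ℝ, 0 ≤ r → HasDerivWithinAt (fun r : ℝ => S.toFun r.toNNReal (z s))
      (S.toFun r.toNNReal (w s)) (Ici 0) r) {t : ℝ} (ht : t ∈ Icc 0 T) :
    HasDerivWithinAt (S.conv a z) (a 0 • z t + (S.conv a' z t + S.conv a w t)) (Icc 0 T) t := by
  -- Constant continuation beyond `[0,T]` makes the kernels continuous on the whole plane.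
  set zz := extendIcc hT z with hzz
  set ww := extendIcc hT w with hww
  have hzc : Continuous zz := (continuous_extendIcc hT hz)
  have hwc : Continuous ww := (continuous_extendIcc hT hw)
  have hd : ∀ s r : ℝ, 0 ≤ r → HasDerivWithinAt (fun r : ℝ => S.toFun r.toNNReal (zz s))
      (S.toFun r.toNNReal (ww s)) (Ici 0) r := fun s r hr =>
    hzw _ (projIcc 0 T hT s).2 r hr
  have hH := (S.continuous_conv_integrand ha' hzc).add (S.continuous_conv_integrand ha hwc)
  have h1 := (hasDerivWithinAt_integral_triangle (φ := fun s => a 0 • zz s)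
    (H := fun τ s => a' (τ - s) • S.toFun (τ - s).toNNReal (zz s) +
      a (τ - s) • S.toFun (τ - s).toNNReal (ww s)) (hzc.const_smul _) hH ht.1).mono
      (Icc_subset_Ici_self : Icc 0 T ⊆ Ici 0)
  have h2 : ∀ t ∈ Icc 0 T, S.conv a z t = ∫ s in (0 : ℝ)..t, (a 0 • zz s + ∫ τ in s..t,
      (a' (τ - s) • S.toFun (τ - s).toNNReal (zz s) +
        a (τ - s) • S.toFun (τ - s).toNNReal (ww s))) := by
    intro t ht
    rw [← S.conv_extend hT a z ht]
    refine intervalIntegral.integral_congr fun s hs => ?_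
    rw [uIcc_of_le ht.1] at hs
    change a (t - s) • S.toFun (t - s).toNNReal (zz s) = _
    -- The kernel is its value `a 0 • zz s` on the diagonal plus the integral of its derivative;
    -- one-sided derivatives are enough.
    have h3 := intervalIntegral.integral_eq_sub_of_hasDeriv_right_of_le
      (f := fun τ => a (τ - s) • S.toFun (τ - s).toNNReal (zz s))
      (f' := fun τ => a' (τ - s) • S.toFun (τ - s).toNNReal (zz s) +
        a (τ - s) • S.toFun (τ - s).toNNReal (ww s)) hs.2
      ((S.continuous_conv_integrand ha hzc).comp
        (by fun_prop : Continuous fun τ : ℝ => (τ, s))).continuousOn ?_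
      ((hH.comp (by fun_prop : Continuous fun τ : ℝ => (τ, s))).intervalIntegrable _ _)
    · simp only [h3, sub_self, Real.toNNReal_zero, S.map_zero]
      simp
    · intro τ hτ
      have e1 : HasDerivAt (fun τ => a (τ - s)) (a' (τ - s)) τ := (had _).comp_sub_const _ _
      have e2 : HasDerivWithinAt (fun τ : ℝ => S.toFun (τ - s).toNNReal (zz s))
          (S.toFun (τ - s).toNNReal (ww s)) (Ioi τ) τ := by
        have := (hd s (τ - s) (sub_nonneg.2 hτ.1.le)).scomp τ
          (((hasDerivAt_id τ).sub_const s).hasDerivWithinAt (s := Ioi τ))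
          fun r hr => sub_nonneg.2 (hτ.1.le.trans (le_of_lt hr))
        simpa [Function.comp_def] using this
      rw [add_comm]
      exact e1.hasDerivWithinAt.smul e2
  refine (h1.congr h2 (h2 t ht)).congr_deriv ?_
  have i1 : Continuous fun s => a' (t - s) • S.toFun (t - s).toNNReal (zz s) :=
    (S.continuous_conv_integrand ha' hzc).comp (by fun_prop : Continuous fun s : ℝ => (t, s))
  have i2 : Continuous fun s => a (t - s) • S.toFun (t - s).toNNReal (ww s) :=
    (S.continuous_conv_integrand ha hwc).comp (by fun_prop : Continuous fun s : ℝ => (t, s))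
  rw [intervalIntegral.integral_add (i1.intervalIntegrable _ _) (i2.intervalIntegrable _ _), ← S.conv_extend hT a' z ht, ← S.conv_extend hT a w ht]
  congr 2
  rw [hzz, extendIcc_of_mem hT _ ht]

/-- After the substitution `r = t - s` the derivative falls on `f`, so the values of `f` need not
lie in the domain of the generator. -/
theorem hasDerivWithinAt_conv_of_hasDerivWithinAt (hT : 0 ≤ T) {a : ℝ → ℝ} (ha : Continuous a)
    {f f' : ℝ → X} (hf : ∀ t ∈ Icc 0 T, HasDerivWithinAt f (f' t) (Icc 0 T) t)
    (hf' : ContinuousOn f' (Icc 0 T)) {t : ℝ} (ht : t ∈ Icc 0 T) :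
    HasDerivWithinAt (S.conv a f) (a t • S.toFun t.toNNReal (f 0) + S.conv a f' t) (Icc 0 T) t := by
  set g := extendIcc hT f' with hg
  have hgc : Continuous g := (continuous_extendIcc hT hf')
  have hfg : ∀ r t, 0 ≤ r → r ≤ t → t ≤ T → f (t - r) = f 0 + ∫ τ in r..t, g (τ - r) := by
    intro r t hr hrt htT
    have htr : t - r ≤ T := by linarith
    rw [intervalIntegral.integral_comp_sub_right, sub_self,
      intervalIntegral.integral_eq_sub_of_hasDeriv_right_of_le (f := f) (sub_nonneg.2 hrt),
      add_sub_cancel]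
    · intro s hs
      exact (hf s ⟨hs.1, hs.2.trans htr⟩).continuousWithinAt.mono (Icc_subset_Icc_right htr)
    · intro s hs
      have hsI : s ∈ Icc 0 T := ⟨hs.1.le, hs.2.le.trans htr⟩
      rw [hg, extendIcc_of_mem hT _ hsI]
      exact ((hf s hsI).hasDerivAt (Icc_mem_nhds hs.1 (hs.2.trans_le htr))).hasDerivWithinAt
    · exact hgc.intervalIntegrable _ _
  have hcomm : ∀ (z : ℝ → X) t, S.conv a z t =
      ∫ r in (0 : ℝ)..t, a r • S.toFun r.toNNReal (z (t - r)) := by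
    intro z t
    have := intervalIntegral.integral_comp_sub_left (a := 0) (b := t)
      (fun s => a (t - s) • S.toFun (t - s).toNNReal (z s)) t
    simp only [sub_sub_cancel, sub_self, sub_zero] at this
    rw [conv, this]
  have hKc : Continuous fun p : ℝ × ℝ => a p.2 • S.toFun p.2.toNNReal (g (p.1 - p.2)) :=
    (ha.comp continuous_snd).smul (S.continuous_apply continuous_snd
      (hgc.comp (by fun_prop)))
  have h1 := (hasDerivWithinAt_integral_triangle
    (φ := fun r => a r • S.toFun r.toNNReal (f 0))
    (H := fun τ r => a r • S.toFun r.toNNReal (g (τ - r)))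
    (ha.smul (S.continuous_apply continuous_id continuous_const)) hKc ht.1).mono
      (Icc_subset_Ici_self : Icc 0 T ⊆ Ici 0)
  have h2 : ∀ t ∈ Icc 0 T, S.conv a f t = ∫ r in (0 : ℝ)..t, (a r • S.toFun r.toNNReal (f 0) +
      ∫ τ in r..t, a r • S.toFun r.toNNReal (g (τ - r))) := by
    intro t ht
    rw [hcomm]
    refine intervalIntegral.integral_congr fun r hr => ?_
    rw [uIcc_of_le ht.1] at hr
    have hgr : Continuous fun τ => g (τ - r) := hgc.comp (by fun_prop)
    rw [hfg r t hr.1 hr.2 ht.2, _root_.map_add, smul_add, intervalIntegral.integral_smul,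
      ContinuousLinearMap.intervalIntegral_comp_comm _ (hgr.intervalIntegrable _ _)]
  refine (h1.congr h2 (h2 t ht)).congr_deriv ?_
  rw [← S.conv_extend hT a f' ht, hcomm]

end C0Semigroup

/-! ### First-order problems, uniqueness and chains -/

namespace FactoredCauchy

variable {X : Type*} [NormedAddCommGroup X] [NormedSpace ℝ X] [CompleteSpace X] {ι : Type*}
  {T : ℝ}

namespace IsResolventFamily

variable {S : ι → C0Semigroup X} {B : ι → X →ₗ.[ℝ] X} {l : ι → ℝ} {R : ι → X →L[ℝ] X}
  (h : IsResolventFamily S B l R)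
include h

omit [CompleteSpace X] in
theorem hasDerivWithinAt_toFun {j : ι} {x : X} (hx : x ∈ (B j).domain) {t : ℝ} (ht : 0 ≤ t) :
    HasDerivWithinAt (fun t : ℝ => (S j).toFun t.toNNReal x)
      ((S j).toFun t.toNNReal (act (B j) x)) (Ici 0) t := by
  have := h.hasDeriv j (l j • x - act (B j) x) t ht
  rwa [h.resolvent_apply hx, sub_sub_cancel] at this

omit [CompleteSpace X] in
theorem act_map {C : X →L[ℝ] X} {j : ι} (hC : Commute C (R j)) {x : X}
    (hx : x ∈ (B j).domain) : C x ∈ (B j).domain ∧ act (B j) (C x) = C (act (B j) x) := by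
  rw [← h.act_iff, ← map_smul, ← map_sub]
  have : R j (C (l j • x - act (B j) x)) = C (R j (l j • x - act (B j) x)) :=
    (DFunLike.congr_fun hC.eq _).symm
  rw [this, h.resolvent_apply hx]

theorem hasDerivWithinAt_conv (hT : 0 ≤ T) {j : ι} {a a' : ℝ → ℝ} (ha : Continuous a)
    (ha' : Continuous a') (had : ∀ r, HasDerivAt a (a' r) r) {z : ℝ → X}
    (hz : ContinuousOn z (Icc 0 T)) (hzd : ∀ t ∈ Icc 0 T, z t ∈ (B j).domain)
    (hw : ContinuousOn (fun t => act (B j) (z t)) (Icc 0 T)) {t : ℝ} (ht : t ∈ Icc 0 T) :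
    HasDerivWithinAt ((S j).conv a z)
      (a 0 • z t + ((S j).conv a' z t + (S j).conv a (fun t => act (B j) (z t)) t))
      (Icc 0 T) t :=
  (S j).hasDerivWithinAt_conv_of_domain hT ha ha' had hz hw
    (fun s hs _ hr => h.hasDerivWithinAt_toFun (hzd s hs) hr) ht

/-- The identity `R i (l i • x - x') = x` describes the graph of `B i` by a bounded operator, which
can be pulled out of the integral. This replaces an appeal to closedness. -/
theorem act_conv {i j : ι} {a : ℝ → ℝ} (ha : Continuous a) {z : ℝ → X}
    (hz : ContinuousOn z (Icc 0 T)) (hzd : ∀ t ∈ Icc 0 T, z t ∈ (B i).domain)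
    (hw : ContinuousOn (fun t => act (B i) (z t)) (Icc 0 T)) {t : ℝ} (ht : t ∈ Icc 0 T) :
    (S j).conv a z t ∈ (B i).domain ∧
      act (B i) ((S j).conv a z t) = (S j).conv a (fun t => act (B i) (z t)) t := by
  have hl : ContinuousOn (fun t => l i • z t) (Icc 0 T) := hz.const_smul _
  have h1 : l i • (S j).conv a z t = (S j).conv a (fun t => l i • z t) t :=
    ((S j).conv_map ha hz (C := l i • (1 : X →L[ℝ] X))
      (fun _ => (Commute.one_left _).smul_left _) ht).symm
  have hs : ContinuousOn (fun s => l i • z s - act (B i) (z s)) (Icc 0 T) := hl.sub hw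
  rw [← h.act_iff, h1, ← (S j).conv_sub ha hl hw ht, ← (S j).conv_map ha hs (h.commute_resolvent_toFun i j) ht]
  exact (S j).conv_congr (fun s hs => h.resolvent_apply (hzd s hs)) ht

/-- The mild solution with differentiable right-hand side is a classical solution. -/
theorem act_conv_one (hT : 0 < T) {j : ι} {f f' : ℝ → X}
    (hf : ∀ t ∈ Icc 0 T, HasDerivWithinAt f (f' t) (Icc 0 T) t) (hf' : ContinuousOn f' (Icc 0 T))
    {t : ℝ} (ht : t ∈ Icc 0 T) :
    (S j).conv (fun _ => 1) f t ∈ (B j).domain ∧ act (B j) ((S j).conv (fun _ => 1) f t) =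
      (S j).toFun t.toNNReal (f 0) + (S j).conv (fun _ => 1) f' t - f t := by
  have h1c : Continuous fun _ : ℝ => (1 : ℝ) := continuous_const
  have hfc : ContinuousOn f (Icc 0 T) := fun t ht => (hf t ht).continuousWithinAt
  have hRc : ContinuousOn (fun t => R j (f t)) (Icc 0 T) := (R j).continuous.comp_continuousOn hfc
  have hRT := h.commute_resolvent_toFun j j
  have hd1 := (S j).hasDerivWithinAt_conv_of_hasDerivWithinAt hT.le h1c hf hf' ht
  have hact : ContinuousOn (fun t => act (B j) (R j (f t))) (Icc 0 T) := by
    simp only [h.act_resolvent]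
    exact (hRc.const_smul _).sub hfc
  have hd2 := h.hasDerivWithinAt_conv hT.le h1c continuous_const
    (fun r => hasDerivAt_const r (1 : ℝ)) hRc (fun t _ => h.resolvent_mem j (f t)) hact ht
  have hd3 : HasDerivWithinAt ((S j).conv (fun _ => 1) fun t => R j (f t))
      (R j ((1 : ℝ) • (S j).toFun t.toNNReal (f 0) + (S j).conv (fun _ => 1) f' t))
      (Icc 0 T) t :=
    ((R j).hasFDerivAt.comp_hasDerivWithinAt t hd1).congr
      (fun s hs => (S j).conv_map h1c hfc hRT hs) ((S j).conv_map h1c hfc hRT ht)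
  have hzero : (S j).conv (fun _ => 0) (fun t => R j (f t)) t = 0 := by
    simp [C0Semigroup.conv]
  have hl : ContinuousOn (fun t => l j • R j (f t)) (Icc 0 T) := hRc.const_smul _
  have h2 : (S j).conv (fun _ => 1) (fun t => l j • R j (f t)) t =
      l j • R j ((S j).conv (fun _ => 1) f t) := by
    refine ((S j).conv_map h1c hfc (C := l j • R j) (fun s => (hRT s).smul_left _) ht)
  -- The convolution with `R j f` is differentiated twice over: `hd3` differentiates `f`, `hd2` the
  -- semigroup, which is possible since `R j f` lies in the domain. Equality of both results is the
  -- resolvent form of the claim.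
  have key := (uniqueDiffOn_Icc hT t ht).eq_deriv _ hd3 hd2
  simp only [h.act_resolvent] at key
  rw [hzero, zero_add, (S j).conv_sub h1c hl hfc ht, h2] at key
  rw [← h.act_iff]
  rw [one_smul, one_smul] at key
  rw [map_sub, map_sub, key, map_smul]
  abel

/-- `act_conv_one` with `f = v` and `f' = B v + g` gives `B (1 * v) = 1 * (B v) + 1 * g - v`, where
`1 *` denotes the convolution. As `B v` is continuous, `B (1 * v) = 1 * (B v)`, and `v = 1 * g`
remains. -/
theorem eq_conv_one (hT : 0 < T) {j : ι} {v g : ℝ → X} (hv0 : v 0 = 0)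
    (hvd : ∀ t ∈ Icc 0 T, v t ∈ (B j).domain)
    (hv : ∀ t ∈ Icc 0 T, HasDerivWithinAt v (act (B j) (v t) + g t) (Icc 0 T) t)
    (hg : ContinuousOn g (Icc 0 T)) (hv' : ContinuousOn (derivWithin v (Icc 0 T)) (Icc 0 T))
    {t : ℝ} (ht : t ∈ Icc 0 T) : v t = (S j).conv (fun _ => 1) g t := by
  have h1c : Continuous fun _ : ℝ => (1 : ℝ) := continuous_const
  have hvc : ContinuousOn v (Icc 0 T) := fun t ht => (hv t ht).continuousWithinAt
  have hd : ∀ t ∈ Icc 0 T, derivWithin v (Icc 0 T) t = act (B j) (v t) + g t := fun t ht =>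
    (hv t ht).derivWithin (uniqueDiffOn_Icc hT t ht)
  have hsum : ContinuousOn (fun t => act (B j) (v t) + g t) (Icc 0 T) :=
    hv'.congr fun t ht => (hd t ht).symm
  have hact : ContinuousOn (fun t => act (B j) (v t)) (Icc 0 T) :=
    (hsum.sub hg).congr fun t _ => by simp
  have h1 := (h.act_conv_one (j := j) hT hv hsum ht).2
  rw [(h.act_conv h1c hvc hvd hact ht).2, hv0, map_zero, zero_add,
    (S j).conv_add h1c hact hg ht, add_sub_assoc, left_eq_add, sub_eq_zero] at h1
  exact h1.symm

end IsResolventFamily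

/-- `(v m)` is the sequence of successive applications of the factors `d/dt - B (a m)`. -/
def IsChain (B : ι → X →ₗ.[ℝ] X) (T : ℝ) (a : ℕ → ι) (n : ℕ) (v : ℕ → ℝ → X) : Prop :=
  ∀ m < n, (∀ t ∈ Icc 0 T, v m t ∈ (B (a m)).domain ∧
    HasDerivWithinAt (v m) (act (B (a m)) (v m t) + v (m + 1) t) (Icc 0 T) t) ∧
    ContinuousOn (derivWithin (v m) (Icc 0 T)) (Icc 0 T)

namespace IsChain

variable {S : ι → C0Semigroup X} {B : ι → X →ₗ.[ℝ] X} {l : ι → ℝ} {R : ι → X →L[ℝ] X}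
  {a : ℕ → ι} {n : ℕ} {v w : ℕ → ℝ → X}

omit [CompleteSpace X] in
theorem continuousOn (hv : IsChain B T a n v) (hn : ContinuousOn (v n) (Icc 0 T)) {m : ℕ}
    (hm : m ≤ n) : ContinuousOn (v m) (Icc 0 T) := by
  rcases hm.lt_or_eq with hm | rfl
  · exact fun t ht => ((hv m hm).1 t ht).2.continuousWithinAt
  · exact hn

theorem eqOn (h : IsResolventFamily S B l R) (hT : 0 < T) (hv : IsChain B T a n v)
    (hw : IsChain B T a n w) (hv0 : ∀ m < n, v m 0 = 0) (hw0 : ∀ m < n, w m 0 = 0)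
    (hn : ContinuousOn (v n) (Icc 0 T)) (hvw : ∀ t ∈ Icc 0 T, v n t = w n t) {m : ℕ}
    (hm : m ≤ n) : ∀ t ∈ Icc 0 T, v m t = w m t := by
  have hn' : ContinuousOn (w n) (Icc 0 T) := hn.congr fun t ht => (hvw t ht).symm
  induction hm using Nat.decreasingInduction with
  | self => exact hvw
  | of_succ m hm ih =>
    intro t ht
    rw [h.eq_conv_one hT (hv0 m hm) (fun t ht => ((hv m hm).1 t ht).1)
        (fun t ht => ((hv m hm).1 t ht).2) (hv.continuousOn hn hm) (hv m hm).2 ht,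
      h.eq_conv_one hT (hw0 m hm) (fun t ht => ((hw m hm).1 t ht).1)
        (fun t ht => ((hw m hm).1 t ht).2) (hw.continuousOn hn' hm) (hw m hm).2 ht]
    exact (S (a m)).conv_congr ih ht

omit [CompleteSpace X] in
theorem map (h : IsResolventFamily S B l R) (hT : 0 < T) (hv : IsChain B T a n v) {C : X →L[ℝ] X}
    (hC : ∀ j, Commute C (R j)) : IsChain B T a n (fun m t => C (v m t)) := by
  intro m hm
  have hd : ∀ t ∈ Icc 0 T, HasDerivWithinAt (fun t => C (v m t))
      (C (act (B (a m)) (v m t) + v (m + 1) t)) (Icc 0 T) t := fun t ht =>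
    C.hasFDerivAt.comp_hasDerivWithinAt t ((hv m hm).1 t ht).2
  refine ⟨fun t ht => ?_, ?_⟩
  · obtain ⟨h1, h2⟩ := h.act_map (hC (a m)) ((hv m hm).1 t ht).1
    refine ⟨h1, ?_⟩
    rw [h2, ← map_add]
    exact hd t ht
  · refine (C.continuous.comp_continuousOn (hv m hm).2).congr fun t ht => ?_
    rw [(hd t ht).derivWithin (uniqueDiffOn_Icc hT t ht), Function.comp_apply,
      ((hv m hm).1 t ht).2.derivWithin (uniqueDiffOn_Icc hT t ht)]

/-- The factors are inverted from the last one down: `v m` is the convolution of its semigroup with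
`v (m+1)`. A `C¹` right-hand side gives a `C¹` solution with values in the domain, so the induction
continues. -/
theorem exists_of_contDiffOn (h : IsResolventFamily S B l R) (hT : 0 < T) (a : ℕ → ι) (n : ℕ)
    {f : ℝ → X} (hf : ContDiffOn ℝ 1 f (Icc 0 T)) :
    ∃ v, IsChain B T a n v ∧ (∀ m < n, v m 0 = 0) ∧ v n = f := by
  have hu := uniqueDiffOn_Icc hT
  suffices H : ∀ m ≤ n, ∃ v : ℕ → ℝ → X, (∀ i, m ≤ i → i < n →
      ((∀ t ∈ Icc 0 T, v i t ∈ (B (a i)).domain ∧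
        HasDerivWithinAt (v i) (act (B (a i)) (v i t) + v (i + 1) t) (Icc 0 T) t) ∧
        ContinuousOn (derivWithin (v i) (Icc 0 T)) (Icc 0 T)) ∧ v i 0 = 0) ∧ v n = f ∧
      ContDiffOn ℝ 1 (v m) (Icc 0 T) by
    obtain ⟨v, h1, h2, -⟩ := H 0 (Nat.zero_le _)
    exact ⟨v, fun m hm => (h1 m (Nat.zero_le _) hm).1, fun m hm => (h1 m (Nat.zero_le _) hm).2, h2⟩
  intro m hm
  induction hm using Nat.decreasingInduction with
  | self => exact ⟨fun _ => f, fun i h1 h2 => absurd h1 (not_le.2 h2), rfl, hf⟩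
  | of_succ m hm ih =>
    obtain ⟨v, h1, h2, h3⟩ := ih
    have h3' : ∀ t ∈ Icc 0 T,
        HasDerivWithinAt (v (m + 1)) (derivWithin (v (m + 1)) (Icc 0 T) t) (Icc 0 T) t :=
      fun t ht => ((h3.differentiableOn one_ne_zero) t ht).hasDerivWithinAt
    have h3c := h3.continuousOn_derivWithin hu le_rfl
    set F := (S (a m)).conv (fun _ => 1) (v (m + 1)) with hF
    have hc1 : Continuous fun _ : ℝ => (1 : ℝ) := continuous_const
    have hFd : ∀ t ∈ Icc 0 T, HasDerivWithinAt F ((S (a m)).toFun t.toNNReal (v (m + 1) 0) +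
        (S (a m)).conv (fun _ => 1) (derivWithin (v (m + 1)) (Icc 0 T)) t) (Icc 0 T) t :=
      fun t ht => by
        simpa using (S (a m)).hasDerivWithinAt_conv_of_hasDerivWithinAt hT.le hc1 h3' h3c ht
    have hFc : ContinuousOn (derivWithin F (Icc 0 T)) (Icc 0 T) := by
      refine ContinuousOn.congr ?_ fun t ht => (hFd t ht).derivWithin (hu t ht)
      exact ((S (a m)).continuous_apply continuous_id continuous_const).continuousOn.add
        ((S (a m)).continuousOn_conv hT.le hc1 h3c)
    have hF1 : ContDiffOn ℝ 1 F (Icc 0 T) := by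
      rw [show (1 : WithTop ℕ∞) = 0 + 1 by simp, contDiffOn_succ_iff_derivWithin hu]
      exact ⟨fun t ht => (hFd t ht).differentiableWithinAt, by simp, contDiffOn_zero.2 hFc⟩
    refine ⟨Function.update v m F, fun i hi1 hi2 => ?_, ?_, ?_⟩
    · rcases hi1.eq_or_lt with rfl | hi
      · rw [Function.update_self, Function.update_of_ne (by omega)]
        refine ⟨⟨fun t ht => ?_, hFc⟩, C0Semigroup.conv_zero_right _ _ _⟩
        obtain ⟨h4, h5⟩ := h.act_conv_one (j := a m) hT h3' h3c ht
        refine ⟨h4, ?_⟩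
        rw [h5, sub_add_cancel]
        exact hFd t ht
      · rw [Function.update_of_ne (by omega), Function.update_of_ne (by omega)]
        exact h1 i hi hi2
    · rw [Function.update_of_ne (by omega), h2]
    · rw [Function.update_self]
      exact hF1

end IsChain

end FactoredCauchy

/-! ### Smoothing by products of resolvents -/

namespace FactoredCauchy

variable {X : Type*} [NormedAddCommGroup X] [NormedSpace ℝ X] {ι : Type*}
  {T : ℝ}

/-- The bounded operators commuting with everything that commutes with all `R j`. -/
def bicommutantRing (R : ι → X →L[ℝ] X) : Subring (X →L[ℝ] X) :=
  Subring.centralizer {D | ∀ j, Commute D (R j)}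

theorem commute_of_mem_bicommutantRing {R : ι → X →L[ℝ] X} {C D : X →L[ℝ] X}
    (hC : C ∈ bicommutantRing R) (hD : ∀ j, Commute D (R j)) : Commute D C :=
  Subring.mem_centralizer_iff.1 hC D hD

theorem resolvent_mem_bicommutantRing (R : ι → X →L[ℝ] X) (j : ι) : R j ∈ bicommutantRing R :=
  Subring.mem_centralizer_iff.2 fun _ hD => hD j

theorem smul_mem_bicommutantRing {R : ι → X →L[ℝ] X} {C : X →L[ℝ] X}
    (hC : C ∈ bicommutantRing R) (r : ℝ) : r • C ∈ bicommutantRing R :=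
  Subring.mem_centralizer_iff.2 fun _ hD =>
    ((commute_of_mem_bicommutantRing hC hD).smul_right r).eq

namespace IsResolventFamily

variable {S : ι → C0Semigroup X} {B : ι → X →ₗ.[ℝ] X} {l : ι → ℝ} {R : ι → X →L[ℝ] X}
  (h : IsResolventFamily S B l R)
include h

theorem commute_mem_resolvent {C : X →L[ℝ] X} (hC : C ∈ bicommutantRing R) (j : ι) :
    Commute C (R j) :=
  (commute_of_mem_bicommutantRing hC fun i => h.commute_resolvent j i).symm

theorem commute_mem_toFun {C : X →L[ℝ] X} (hC : C ∈ bicommutantRing R) (j : ι) (t : ℝ≥0) :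
    Commute C ((S j).toFun t) :=
  (commute_of_mem_bicommutantRing hC fun i => (h.commute_resolvent_toFun i j t).symm).symm

theorem commute_mem_mem {C D : X →L[ℝ] X} (hC : C ∈ bicommutantRing R)
    (hD : D ∈ bicommutantRing R) : Commute C D :=
  commute_of_mem_bicommutantRing hD (h.commute_mem_resolvent hC)

/-- An injective operator that has all resolvents as factors. -/
theorem exists_smoothing [Fintype ι] : ∃ Q ∈ bicommutantRing R, Function.Injective Q ∧
    ∀ j, ∃ Q' ∈ bicommutantRing R, Q = R j * Q' := by
  classical
  suffices H : ∀ s : Finset ι, ∃ Q ∈ bicommutantRing R, Function.Injective Q ∧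
      ∀ j ∈ s, ∃ Q' ∈ bicommutantRing R, Q = R j * Q' by
    obtain ⟨Q, h1, h2, h3⟩ := H Finset.univ
    exact ⟨Q, h1, h2, fun j => h3 j (Finset.mem_univ j)⟩
  intro s
  induction s using Finset.induction_on with
  | empty => exact ⟨1, one_mem _, fun _ _ h => h, by simp⟩
  | insert i s _ ih =>
    obtain ⟨Q, h1, h2, h3⟩ := ih
    refine ⟨R i * Q, mul_mem (resolvent_mem_bicommutantRing R i) h1,
      (h.resolvent_injective i).comp h2, fun j hj => ?_⟩
    rcases Finset.mem_insert.1 hj with rfl | hj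
    · exact ⟨Q, h1, rfl⟩
    · obtain ⟨Q', h4, rfl⟩ := h3 j hj
      refine ⟨R i * Q', mul_mem (resolvent_mem_bicommutantRing R i) h4, ?_⟩
      rw [← mul_assoc, (h.commute_resolvent i j).eq, mul_assoc]

/-- Because `Q` contains `R j` as a factor, `B j Q` is the bounded operator `l j R j Q' - Q'`. Each
application of some `B j` uses up one power of `Q`. -/
theorem smoothPath_smoothing {Q : X →L[ℝ] X} (hQ : Q ∈ bicommutantRing R)
    (hQ' : ∀ j, ∃ Q' ∈ bicommutantRing R, Q = R j * Q') (N : ℕ) {z : ℝ → X}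
    (hz : ContinuousOn z (Icc 0 T)) : SmoothPath B T N (fun t => (Q ^ N) (z t)) := by
  induction N generalizing z with
  | zero => simpa [SmoothPath] using hz
  | succ N ih =>
    refine ⟨(Q ^ (N + 1)).continuous.comp_continuousOn hz, fun j => ?_⟩
    obtain ⟨Q', h1, h2⟩ := hQ' j
    have e1 : ∀ x, (Q ^ (N + 1)) x = R j (Q' ((Q ^ N) x)) := fun x => by
      rw [pow_succ', h2]; rfl
    refine ⟨fun t _ => ?_, ?_⟩
    · change (Q ^ (N + 1)) (z t) ∈ (B j).domain
      rw [e1]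
      exact h.resolvent_mem _ _
    · let E : X →L[ℝ] X := l j • (R j * Q') - Q'
      have hE : E ∈ bicommutantRing R := sub_mem
        (smul_mem_bicommutantRing (mul_mem (resolvent_mem_bicommutantRing R j) h1) _) h1
      refine (ih (E.continuous.comp_continuousOn hz)).congr fun t _ => ?_
      change act (B j) ((Q ^ (N + 1)) (z t)) = _
      rw [e1, h.act_resolvent]
      have : (Q ^ N) (E (z t)) = E ((Q ^ N) (z t)) :=
        DFunLike.congr_fun (h.commute_mem_mem (pow_mem hQ N) hE).eq (z t)
      rw [Function.comp_apply, this]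
      rfl

theorem iterate_act_map {C : X →L[ℝ] X} {j : ι} (hC : Commute C (R j)) {x : X} {q : ℕ}
    (hx : ∀ p < q, (act (B j))^[p] x ∈ (B j).domain) :
    (act (B j))^[q] (C x) = C ((act (B j))^[q] x) := by
  induction q with
  | zero => rfl
  | succ q ih =>
    rw [Function.iterate_succ_apply', Function.iterate_succ_apply',
      ih fun p hp => hx p (by omega), (h.act_map hC (hx q (by omega))).2]

variable [Fintype ι] [DecidableEq ι] {n : ℕ} {σ : Fin n → ι}

theorem mulM_map {C : X →L[ℝ] X} (hC : ∀ j, Commute C (R j)) {y : Col σ → X}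
    (hy : ∀ c, InDom B σ c (y c)) : mulM B σ (fun c => C (y c)) = fun r => C (mulM B σ y r) := by
  funext r
  rw [mulM, mulM, map_sum]
  refine Finset.sum_congr rfl fun c _ => ?_
  by_cases hr : (r : ℕ) < c.2
  · rw [Nat.choose_eq_zero_of_lt hr]
    simp
  · rw [map_smul, h.iterate_act_map (hC _) fun p hp => hy c p (by omega)]

end IsResolventFamily

namespace IsChain

variable {S : ι → C0Semigroup X} {B : ι → X →ₗ.[ℝ] X} {l : ι → ℝ} {R : ι → X →L[ℝ] X}
  {a : ℕ → ι} {n : ℕ} {v w : ℕ → ℝ → X}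

/-- In `v m' = A v m + v (m+1)` one factor `Q` makes `A` bounded. So a derivative costs one power of
`Q` and moves at most one place along the chain, whose members before `v n` vanish at `0`. The
operator `C` absorbs the bounded factors that the induction produces. -/
theorem contDiffOn_smoothing (h : IsResolventFamily S B l R) (hT : 0 < T)
    (hv : IsChain B T a n v) (hv0 : ∀ m < n, v m 0 = 0) {Q : X →L[ℝ] X}
    (hQ : Q ∈ bicommutantRing R) (hQ' : ∀ j, ∃ Q' ∈ bicommutantRing R, Q = R j * Q') (k : ℕ) :
    ∀ m, m + k < n → ∀ C : X →L[ℝ] X, ContDiffOn ℝ k (fun t => C ((Q ^ k) (v m t))) (Icc 0 T) ∧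
      iteratedDerivWithin k (fun t => C ((Q ^ k) (v m t))) (Icc 0 T) 0 = 0 := by
  have hu := uniqueDiffOn_Icc hT
  have h0 : (0 : ℝ) ∈ Icc 0 T := ⟨le_rfl, hT.le⟩
  induction k with
  | zero =>
    intro m hm C
    constructor
    · refine contDiffOn_zero.2 ?_
      exact C.continuous.comp_continuousOn fun t ht => ((hv m hm).1 t ht).2.continuousWithinAt
    · simp [hv0 m hm]
  | succ k ih =>
    intro m hm C
    obtain ⟨Q', h1, h2⟩ := hQ' (a m)
    have hE : l (a m) • R (a m) - 1 ∈ bicommutantRing R :=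
      sub_mem (smul_mem_bicommutantRing (resolvent_mem_bicommutantRing R _) _) (one_mem _)
    obtain ⟨c1, d1⟩ := ih m (by omega) (C * Q' * (l (a m) • R (a m) - 1))
    obtain ⟨c2, d2⟩ := ih (m + 1) (by omega) (C * Q)
    have hd : ∀ t ∈ Icc 0 T, HasDerivWithinAt (fun t => C ((Q ^ (k + 1)) (v m t)))
        ((C * Q' * (l (a m) • R (a m) - 1)) ((Q ^ k) (v m t)) +
          (C * Q) ((Q ^ k) (v (m + 1) t))) (Icc 0 T) t := by
      intro t ht
      obtain ⟨hd1, hd2⟩ := (hv m (by omega)).1 t ht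
      refine ((C * Q ^ (k + 1)).hasFDerivAt.comp_hasDerivWithinAt t hd2).congr_deriv ?_
      rw [map_add]
      congr 1
      · have e1 : Q ^ (k + 1) = Q' * Q ^ k * R (a m) := by
          have hq : Q' * R (a m) = Q := by rw [h2, (h.commute_mem_resolvent h1 (a m)).eq]
          rw [← (h.commute_mem_mem (pow_mem hQ k) h1).eq, mul_assoc, hq, pow_succ]
        have e2 : R (a m) (act (B (a m)) (v m t)) = (l (a m) • R (a m) - 1) (v m t) := by
          have := h.resolvent_apply hd1
          rw [map_sub, map_smul, sub_eq_iff_eq_add] at this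
          exact (sub_eq_of_eq_add' this).symm
        rw [e1]
        change C (Q' ((Q ^ k) (R (a m) (act (B (a m)) (v m t))))) =
          C (Q' ((l (a m) • R (a m) - 1) ((Q ^ k) (v m t))))
        rw [e2]
        exact congrArg (fun x => C (Q' x))
          (DFunLike.congr_fun (h.commute_mem_mem (pow_mem hQ k) hE).eq (v m t))
      · rw [pow_succ']; rfl
    have hdw : EqOn (derivWithin (fun t => C ((Q ^ (k + 1)) (v m t))) (Icc 0 T))
        (fun t => (C * Q' * (l (a m) • R (a m) - 1)) ((Q ^ k) (v m t)) +
          (C * Q) ((Q ^ k) (v (m + 1) t))) (Icc 0 T) := fun t ht =>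
      (hd t ht).derivWithin (hu t ht)
    constructor
    · rw [Nat.cast_succ, contDiffOn_succ_iff_derivWithin hu]
      exact ⟨fun t ht => (hd t ht).differentiableWithinAt, by simp, (c1.add c2).congr hdw⟩
    · rw [iteratedDerivWithin_succ', iteratedDerivWithin_congr hdw h0]
      rw [iteratedDerivWithin_fun_add h0 hu (c1 0 h0) (c2 0 h0), d1, d2, add_zero]

/-- The `k`-th derivative of `Q ^ k` applied to `v 0` vanishes at `0`. When `v 0` is itself `C^k`,
the injective `Q ^ k` can be pulled out and cancelled. -/
theorem iteratedDerivWithin_eq_zero [Fintype ι] (h : IsResolventFamily S B l R) (hT : 0 < T)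
    (hv : IsChain B T a n v) (hv0 : ∀ m < n, v m 0 = 0) {k : ℕ} (hk : k < n)
    (hc : ContDiffOn ℝ k (v 0) (Icc 0 T)) : iteratedDerivWithin k (v 0) (Icc 0 T) 0 = 0 := by
  obtain ⟨Q, h1, h2, h3⟩ := h.exists_smoothing
  have h4 := (contDiffOn_smoothing h hT hv hv0 h1 h3 k 0 (by omega) 1).2
  have h0 : (0 : ℝ) ∈ Icc 0 T := ⟨le_rfl, hT.le⟩
  have h5 : iteratedDerivWithin k (fun t => (Q ^ k) (v 0 t)) (Icc 0 T) 0 =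
      (Q ^ k) (iteratedDerivWithin k (v 0) (Icc 0 T) 0) := by
    rw [iteratedDerivWithin, iteratedDerivWithin]
    have := (Q ^ k).iteratedFDerivWithin_comp_left (hc 0 h0) (uniqueDiffOn_Icc hT) h0
      (i := k) le_rfl
    exact congrArg (fun A => A fun _ => (1 : ℝ)) this
  have h6 : (Q ^ k) (iteratedDerivWithin k (v 0) (Icc 0 T) 0) = (Q ^ k) 0 := by
    rw [← h5, map_zero]
    exact h4
  have hinj : Function.Injective (Q ^ k) := by
    rw [FunLike.coe_pow_eq_iterate]
    exact h2.iterate k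
  exact hinj h6

end IsChain

end FactoredCauchy

/-! ### Calculus of the solution formula with smooth coefficients -/

namespace FactoredCauchy

variable {X : Type*} [NormedAddCommGroup X] [NormedSpace ℝ X] {ι : Type*}

/-- Used for index shifts: differentiating `t^k / k!` lowers `k` by one, and the top coefficient
shifted in is zero. -/
theorem sum_range_of_succ_eq {M : Type*} [AddCommMonoid M] {p q : ℕ → M} {n : ℕ} (h0 : p 0 = 0)
    (hs : ∀ k, p (k + 1) = q k) (hq : ∀ k, k + 1 = n → q k = 0) :
    ∑ k ∈ Finset.range n, p k = ∑ k ∈ Finset.range n, q k := by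
  cases n with
  | zero => simp
  | succ n =>
    rw [Finset.sum_range_succ', Finset.sum_range_succ, h0, hq n rfl]
    simp only [hs]

/-- The function `t ^ k / k!`. -/
def expMono (k : ℕ) (t : ℝ) : ℝ := t ^ k / (Nat.factorial k : ℝ)

/-- The derivative of `expMono k`. -/
def expMonoDeriv : ℕ → ℝ → ℝ
  | 0 => fun _ => 0
  | k + 1 => expMono k

theorem continuous_expMono (k : ℕ) : Continuous (expMono k) := by
  unfold expMono
  fun_prop

theorem continuous_expMonoDeriv (k : ℕ) : Continuous (expMonoDeriv k) := by
  cases k with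
  | zero => exact continuous_const
  | succ k => exact continuous_expMono k

theorem hasDerivAt_expMono (k : ℕ) (t : ℝ) : HasDerivAt (expMono k) (expMonoDeriv k t) t := by
  cases k with
  | zero =>
    have e : expMono 0 = fun _ => 1 := by
      funext t
      simp [expMono]
    rw [e]
    exact hasDerivAt_const t (1 : ℝ)
  | succ k =>
    refine ((hasDerivAt_pow (k + 1) t).div_const _).congr_deriv ?_
    rw [expMonoDeriv, expMono, Nat.factorial_succ, Nat.cast_mul]
    have : (Nat.factorial k : ℝ) ≠ 0 := Nat.cast_ne_zero.2 (Nat.factorial_ne_zero k)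
    have : ((k + 1 : ℕ) : ℝ) ≠ 0 := Nat.cast_ne_zero.2 (Nat.succ_ne_zero k)
    simp only [Nat.add_sub_cancel]
    field_simp

theorem expMono_zero (k : ℕ) : expMono k 0 = if k = 0 then 1 else 0 := by
  cases k <;> simp [expMono]

/-- `∑_j ∑_{k < μ j} (t^k / k! T_j(t) y(j,k) + ∫_0^t (t-s)^k / k! T_j(t-s) z(j,k)(s) ds)`. -/
def famSol [Fintype ι] (S : ι → C0Semigroup X) (μ : ι → ℕ) (y : ι → ℕ → X) (z : ι → ℕ → ℝ → X)
    (t : ℝ) : X :=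
  ∑ j, ∑ k ∈ Finset.range (μ j), (expMono k t • (S j).toFun t.toNNReal (y j k) +
    (S j).conv (expMono k) (z j k) t)

/-- The effect on the coefficients `y` of applying `d/dt - α` to `∑ t^k / k! T_j(t) y(j,k)`. -/
def famStep (B : ι → X →ₗ.[ℝ] X) (α : X → X) (y : ι → ℕ → X) : ι → ℕ → X :=
  fun j k => y j (k + 1) + act (B j) (y j k) - α (y j k)

/-- The effect of applying `d/dt - α 0`, …, `d/dt - α (m-1)`. -/
def famIter (B : ι → X →ₗ.[ℝ] X) (α : ℕ → X → X) (y : ι → ℕ → X) : ℕ → ι → ℕ → X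
  | 0 => y
  | m + 1 => famStep B (α m) (famIter B α y m)

/-- `famStep` pointwise. -/
def pathStep (B : ι → X →ₗ.[ℝ] X) (α : X → X) (z : ι → ℕ → ℝ → X) : ι → ℕ → ℝ → X :=
  fun j k t => famStep B α (fun j k => z j k t) j k

/-- `famIter` pointwise. -/
def pathIter (B : ι → X →ₗ.[ℝ] X) (α : ℕ → X → X) (z : ι → ℕ → ℝ → X) (m : ℕ) : ι → ℕ → ℝ → X :=
  fun j k t => famIter B α (fun j k => z j k t) m j k

theorem pathIter_succ (B : ι → X →ₗ.[ℝ] X) (α : ℕ → X → X) (z : ι → ℕ → ℝ → X) (m : ℕ) :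
    pathIter B α z (m + 1) = pathStep B (α m) (pathIter B α z m) := rfl

/-- Smooth coefficients, vanishing beyond the multiplicities `μ`. -/
structure IsVec (B : ι → X →ₗ.[ℝ] X) (μ : ι → ℕ) (N : ℕ) (y : ι → ℕ → X) : Prop where
  smooth : ∀ j k, y j k ∈ smooth B N
  vanish : ∀ j k, μ j ≤ k → y j k = 0

/-- Smooth families of paths, vanishing beyond the multiplicities `μ`. -/
structure IsPath (B : ι → X →ₗ.[ℝ] X) (T : ℝ) (μ : ι → ℕ) (N : ℕ) (z : ι → ℕ → ℝ → X) : Prop where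
  smooth : ∀ j k, SmoothPath B T N (z j k)
  vanish : ∀ j k, μ j ≤ k → ∀ t ∈ Icc 0 T, z j k t = 0

/-- A map with `α 0 = 0` that lowers the smoothness of paths by at most one. -/
structure Lowers (B : ι → X →ₗ.[ℝ] X) (T : ℝ) (α : X → X) : Prop where
  zero : α 0 = 0
  smoothPath : ∀ N g, SmoothPath B T (N + 1) g → SmoothPath B T N fun t => α (g t)

theorem lowers_act (B : ι → X →ₗ.[ℝ] X) (T : ℝ) (j : ι) : Lowers B T (act (B j)) :=
  ⟨act_zero _, fun _ _ hg => (hg.2 j).2⟩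

theorem lowers_zero (B : ι → X →ₗ.[ℝ] X) (T : ℝ) : Lowers B T fun _ => 0 :=
  ⟨rfl, fun N _ _ => smoothPath_zero N⟩

variable {B : ι → X →ₗ.[ℝ] X} {T : ℝ} {μ : ι → ℕ} {N : ℕ} {y : ι → ℕ → X} {z : ι → ℕ → ℝ → X}

theorem IsPath.isVec (hz : IsPath B T μ N z) {t : ℝ} (ht : t ∈ Icc 0 T) :
    IsVec B μ N fun j k => z j k t :=
  ⟨fun j k => (hz.smooth j k).mem_smooth ht, fun j k hk => hz.vanish j k hk t ht⟩

theorem IsVec.isPath (hy : IsVec B μ N y) (T : ℝ) : IsPath B T μ N fun j k _ => y j k :=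
  ⟨fun j k => smoothPath_const (hy.smooth j k), fun j k hk _ _ => hy.vanish j k hk⟩

theorem isVec_zero : IsVec B μ N fun _ _ => 0 :=
  ⟨fun _ _ => SmoothPath.mem_smooth (g := fun _ => 0) (t := 0)
    (smoothPath_zero (B := B) (T := 0) N) (by simp), fun _ _ _ => rfl⟩

theorem IsPath.step (hz : IsPath B T μ (N + 1) z) {α : X → X} (hα : Lowers B T α) :
    IsPath B T μ N (pathStep B α z) := by
  refine ⟨fun j k => ?_, fun j k hk t ht => ?_⟩
  · exact ((hz.smooth j (k + 1)).of_succ.add ((hz.smooth j k).2 j).2).sub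
      (hα.smoothPath N _ (hz.smooth j k))
  · simp only [pathStep, famStep]
    rw [hz.vanish j k hk t ht, hz.vanish j (k + 1) (by omega) t ht, hα.zero, act_zero]
    simp

theorem IsPath.iter {n : ℕ} (hz : IsPath B T μ n z) {α : ℕ → X → X} (hα : ∀ m, Lowers B T (α m))
    {m : ℕ} (hN : N + m = n) : IsPath B T μ N (pathIter B α z m) := by
  induction m generalizing N with
  | zero =>
    obtain rfl : N = n := hN
    exact hz
  | succ m ih =>
    rw [pathIter_succ]
    exact (ih (N := N + 1) (by omega)).step (hα m)

theorem IsVec.iter {n : ℕ} (hT : 0 ≤ T) (hy : IsVec B μ n y) {α : ℕ → X → X}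
    (hα : ∀ m, Lowers B T (α m)) {m : ℕ} (hN : N + m = n) : IsVec B μ N (famIter B α y m) :=
  ((hy.isPath T).iter hα hN).isVec (t := 0) ⟨le_rfl, hT⟩

/-- If the factor applied is `B j` itself, only the shift `k ↦ k + 1` remains in column `j`. Other
factors do not lengthen the column, so every occurrence of `j` shortens it by one. -/
theorem famIter_eq_zero [DecidableEq ι] (hy : ∀ j k, μ j ≤ k → y j k = 0) (a : ℕ → ι) (m : ℕ)
    {j : ι} {k : ℕ}
    (hk : μ j ≤ k + ((Finset.range m).filter fun i => a i = j).card) :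
    famIter B (fun i => act (B (a i))) y m j k = 0 := by
  induction m generalizing k with
  | zero => exact hy j k (by simpa using hk)
  | succ m ih =>
    rw [Finset.range_add_one, Finset.filter_insert] at hk
    simp only [famIter, famStep]
    by_cases h : a m = j
    · rw [if_pos h, Finset.card_insert_of_notMem (by simp)] at hk
      rw [h, add_sub_cancel_right]
      exact ih (by omega)
    · rw [if_neg h] at hk
      rw [ih hk, ih (by omega), act_zero, act_zero]
      simp

section Solution

variable [Fintype ι] {S : ι → C0Semigroup X} {l : ι → ℝ} {R : ι → X →L[ℝ] X}

theorem famSol_congr {y' : ι → ℕ → X} {z' : ι → ℕ → ℝ → X} (hy : ∀ j k, y j k = y' j k)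
    (hz : ∀ j k, ∀ t ∈ Icc 0 T, z j k t = z' j k t) {t : ℝ} (ht : t ∈ Icc 0 T) :
    famSol S μ y z t = famSol S μ y' z' t := by
  refine Finset.sum_congr rfl fun j _ => Finset.sum_congr rfl fun k _ => ?_
  rw [hy, (S j).conv_congr (hz j k) ht]

theorem famSol_zero_right (t : ℝ) : famSol S μ y (fun _ _ _ => 0) t =
    ∑ j, ∑ k ∈ Finset.range (μ j), expMono k t • (S j).toFun t.toNNReal (y j k) := by
  simp [famSol, C0Semigroup.conv]

theorem famSol_zero_left (t : ℝ) : famSol S μ (fun _ _ => 0) z t =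
    ∑ j, ∑ k ∈ Finset.range (μ j), (S j).conv (expMono k) (z j k) t := by
  simp [famSol]

theorem famSol_at_zero (hy : ∀ j k, μ j ≤ k → y j k = 0) : famSol S μ y z 0 = ∑ j, y j 0 := by
  refine Finset.sum_congr rfl fun j _ => ?_
  simp only [C0Semigroup.conv_zero_right, Real.toNNReal_zero, (S j).map_zero, add_zero,
    expMono_zero]
  simp only [ite_smul, one_smul, zero_smul, ContinuousLinearMap.id_apply, Finset.sum_ite_eq',
    Finset.mem_range]
  split_ifs with h
  · rfl
  · exact (hy j 0 (by omega)).symm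

variable [CompleteSpace X]

theorem famSol_map {C : X →L[ℝ] X} (hC : ∀ j t, Commute C ((S j).toFun t))
    (hz : ∀ j k, ContinuousOn (z j k) (Icc 0 T)) {t : ℝ} (ht : t ∈ Icc 0 T) :
    famSol S μ (fun j k => C (y j k)) (fun j k t => C (z j k t)) t = C (famSol S μ y z t) := by
  rw [famSol, famSol, map_sum]
  refine Finset.sum_congr rfl fun j _ => ?_
  rw [map_sum]
  refine Finset.sum_congr rfl fun k _ => ?_
  have : C ((S j).toFun t.toNNReal (y j k)) = (S j).toFun t.toNNReal (C (y j k)) :=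
    DFunLike.congr_fun (hC j _).eq _
  rw [map_add, map_smul, this, (S j).conv_map (continuous_expMono k) (hz j k) (hC j) ht]

theorem famSol_sub {y' : ι → ℕ → X} {z' : ι → ℕ → ℝ → X}
    (hz : ∀ j k, ContinuousOn (z j k) (Icc 0 T)) (hz' : ∀ j k, ContinuousOn (z' j k) (Icc 0 T))
    {t : ℝ} (ht : t ∈ Icc 0 T) :
    famSol S μ (fun j k => y j k - y' j k) (fun j k t => z j k t - z' j k t) t =
      famSol S μ y z t - famSol S μ y' z' t := by
  simp only [famSol, ← Finset.sum_sub_distrib]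
  refine Finset.sum_congr rfl fun j _ => Finset.sum_congr rfl fun k _ => ?_
  rw [(S j).conv_sub (continuous_expMono k) (hz j k) (hz' j k) ht, map_sub, smul_sub]
  abel

theorem continuousOn_famSol (hT : 0 ≤ T) (hz : ∀ j k, ContinuousOn (z j k) (Icc 0 T)) :
    ContinuousOn (famSol S μ y z) (Icc 0 T) := by
  refine continuousOn_finsetSum _ fun j _ => continuousOn_finsetSum _ fun k _ => ?_
  exact ((continuous_expMono k).smul
    ((S j).continuous_apply continuous_id continuous_const)).continuousOn.add
    ((S j).continuousOn_conv hT (continuous_expMono k) (hz j k))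

theorem act_famSol (h : IsResolventFamily S B l R) (hy : IsVec B μ (N + 1) y)
    (hz : IsPath B T μ (N + 1) z) (i : ι) {t : ℝ} (ht : t ∈ Icc 0 T) :
    famSol S μ y z t ∈ (B i).domain ∧ act (B i) (famSol S μ y z t) =
      famSol S μ (fun j k => act (B i) (y j k)) (fun j k t => act (B i) (z j k t)) t := by
  have hzc : ∀ j k, ContinuousOn (z j k) (Icc 0 T) := fun j k => (hz.smooth j k).continuousOn
  have hzc' : ∀ j k, ContinuousOn (fun t => act (B i) (z j k t)) (Icc 0 T) := fun j k =>
    ((hz.smooth j k).2 i).2.continuousOn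
  have hlc : ∀ j k, ContinuousOn (fun t => l i • z j k t) (Icc 0 T) := fun j k =>
    (hzc j k).const_smul _
  have hsc : ∀ j k, ContinuousOn (fun t => l i • z j k t - act (B i) (z j k t)) (Icc 0 T) :=
    fun j k => (hlc j k).sub (hzc' j k)
  have h1 : l i • famSol S μ y z t =
      famSol S μ (fun j k => l i • y j k) (fun j k t => l i • z j k t) t :=
    (famSol_map (C := l i • (1 : X →L[ℝ] X)) (fun _ _ => (Commute.one_left _).smul_left _)
      hzc ht).symm
  rw [← h.act_iff, h1, ← famSol_sub hlc hzc' ht,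
    ← famSol_map (fun j => h.commute_resolvent_toFun i j) hsc ht]
  exact famSol_congr (fun j k => h.resolvent_apply ((hy.smooth j k) i).1)
    (fun j k t ht => h.resolvent_apply (((hz.smooth j k).2 i).1 t ht)) ht

/-- The additional term `∑ j, z j 0 t` is the diagonal value of the convolution kernels, since `t^k
/ k!` at `0` is nonzero only for `k = 0`. -/
theorem hasDerivWithinAt_famSol (h : IsResolventFamily S B l R) (hT : 0 ≤ T)
    (hy : IsVec B μ (N + 1) y) (hz : IsPath B T μ (N + 1) z) {t : ℝ} (ht : t ∈ Icc 0 T) :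
    HasDerivWithinAt (famSol S μ y z)
      (famSol S μ (famStep B (fun _ => 0) y) (pathStep B (fun _ => 0) z) t + ∑ j, z j 0 t)
      (Icc 0 T) t := by
  have hzc : ∀ j k, ContinuousOn (z j k) (Icc 0 T) := fun j k => (hz.smooth j k).continuousOn
  have hzc' : ∀ j k, ContinuousOn (fun t => act (B j) (z j k t)) (Icc 0 T) := fun j k =>
    ((hz.smooth j k).2 j).2.continuousOn
  have h1 : ∀ j k, HasDerivWithinAt (fun t => expMono k t • (S j).toFun t.toNNReal (y j k) +
      (S j).conv (expMono k) (z j k) t)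
      ((expMono k t • (S j).toFun t.toNNReal (act (B j) (y j k)) +
        expMonoDeriv k t • (S j).toFun t.toNNReal (y j k)) +
        (expMono k 0 • z j k t + ((S j).conv (expMonoDeriv k) (z j k) t +
        (S j).conv (expMono k) (fun t => act (B j) (z j k t)) t))) (Icc 0 T) t := fun j k =>
    ((hasDerivAt_expMono k t).hasDerivWithinAt.smul
      ((h.hasDerivWithinAt_toFun ((hy.smooth j k) j).1 ht.1).mono Icc_subset_Ici_self)).add
      (h.hasDerivWithinAt_conv hT (continuous_expMono k) (continuous_expMonoDeriv k)
        (hasDerivAt_expMono k) (hzc j k) ((hz.smooth j k).2 j).1 (hzc' j k) ht)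
  have h2 : HasDerivWithinAt (famSol S μ y z) _ (Icc 0 T) t := HasDerivWithinAt.fun_sum fun j _ =>
    HasDerivWithinAt.fun_sum fun k (_ : k ∈ Finset.range (μ j)) => h1 j k
  refine h2.congr_deriv ?_
  rw [famSol, ← Finset.sum_add_distrib]
  refine Finset.sum_congr rfl fun j _ => ?_
  have e1 : ∑ k ∈ Finset.range (μ j), expMonoDeriv k t • (S j).toFun t.toNNReal (y j k) =
      ∑ k ∈ Finset.range (μ j), expMono k t • (S j).toFun t.toNNReal (y j (k + 1)) := by
    refine sum_range_of_succ_eq (by simp [expMonoDeriv]) (fun k => rfl) fun k hk => ?_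
    rw [hy.vanish j (k + 1) (by omega), map_zero, smul_zero]
  have e2 : ∑ k ∈ Finset.range (μ j), (S j).conv (expMonoDeriv k) (z j k) t =
      ∑ k ∈ Finset.range (μ j), (S j).conv (expMono k) (z j (k + 1)) t := by
    refine sum_range_of_succ_eq (by simp [expMonoDeriv, C0Semigroup.conv]) (fun k => rfl)
      fun k hk => ?_
    rw [(S j).conv_congr (z' := fun _ => 0) (hz.vanish j (k + 1) (by omega)) ht]
    simp [C0Semigroup.conv]
  have e3 : ∑ k ∈ Finset.range (μ j), expMono k 0 • z j k t = z j 0 t := by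
    simp only [expMono_zero, ite_smul, one_smul, zero_smul, Finset.sum_ite_eq', Finset.mem_range]
    split_ifs with h
    · rfl
    · exact (hz.vanish j 0 (by omega) t ht).symm
  have e4 : ∀ k, (S j).conv (expMono k) (pathStep B (fun _ => 0) z j k) t =
      (S j).conv (expMono k) (z j (k + 1)) t +
        (S j).conv (expMono k) (fun t => act (B j) (z j k t)) t := fun k => by
    rw [← (S j).conv_add (continuous_expMono k) (hzc j (k + 1)) (hzc' j k) ht]
    exact (S j).conv_congr (fun t _ => by simp [pathStep, famStep]) ht
  simp only [e4, famStep, sub_zero, map_add, smul_add, Finset.sum_add_distrib, e1, e2, e3]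
  abel

theorem hasDerivWithinAt_famSol_act (h : IsResolventFamily S B l R) (hT : 0 ≤ T)
    (hy : IsVec B μ (N + 1) y) (hz : IsPath B T μ (N + 1) z) (i : ι) {t : ℝ} (ht : t ∈ Icc 0 T) :
    HasDerivWithinAt (famSol S μ y z) (act (B i) (famSol S μ y z t) +
      (famSol S μ (famStep B (act (B i)) y) (pathStep B (act (B i)) z) t + ∑ j, z j 0 t))
      (Icc 0 T) t := by
  refine (hasDerivWithinAt_famSol h hT hy hz ht).congr_deriv ?_
  rw [(act_famSol h hy hz i ht).2, ← add_assoc, add_left_inj]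
  have hp := hz.step (lowers_zero B T)
  rw [← sub_eq_iff_eq_add', ← famSol_sub (fun j k => (hp.smooth j k).continuousOn)
    (fun j k => ((hz.smooth j k).2 i).2.continuousOn) ht]
  exact famSol_congr (fun j k => by simp [famStep]) (fun j k t _ => by simp [famStep, pathStep]) ht

end Solution

end FactoredCauchy

/-! ### Rows of the operator matrix and initial data -/

namespace FactoredCauchy

variable {X : Type*} [NormedAddCommGroup X] [NormedSpace ℝ X] {ι : Type*}
  {B : ι → X →ₗ.[ℝ] X} {T : ℝ} {μ : ι → ℕ} {n : ℕ}

theorem iterate_act_mem_smooth {N p : ℕ} {x : X} (hx : x ∈ smooth B (N + p)) (j : ι) :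
    (act (B j))^[p] x ∈ smooth B N := by
  induction p generalizing x with
  | zero => exact hx
  | succ p ih => exact ih (hx j).2

theorem smooth_mono {N M : ℕ} (hM : M ≤ N) {x : X} (hx : x ∈ smooth B N) : x ∈ smooth B M :=
  SmoothPath.mem_smooth (g := fun _ => x) (T := 0) (t := 0) ((smoothPath_const hx).mono hM)
    (by simp)

namespace Model

variable {K Y : Type*} [CommRing K] [AddCommGroup Y] [Module K Y] (m : Model B K Y)

theorem smul_pow_smul_mem_range {x : X} {q : ℕ} (hx : x ∈ smooth B (q + 1)) (i j : ι) :
    m.b i • m.b j ^ q • m.e x ∈ m.e.range := by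
  rw [← m.e_iterate_act fun p hp => iterate_act_mem hx (by omega) j,
    ← m.e_act ((iterate_act_mem_smooth (N := 1) (by rwa [add_comm]) j) i).1]
  exact ⟨_, rfl⟩

variable [Fintype ι]

/-- Row `r` of the confluent Vandermonde matrix, applied to a family. -/
def row (μ : ι → ℕ) (r : ℕ) (η : ι → ℕ → Y) : Y :=
  ∑ j, ∑ k ∈ Finset.range (μ j), ((Nat.choose r k : K) * m.b j ^ (r - k)) • η j k

theorem row_zero {η : ι → ℕ → Y} (hη : ∀ j k, μ j ≤ k → η j k = 0) :
    m.row μ 0 η = ∑ j, η j 0 := by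
  refine Finset.sum_congr rfl fun j _ => ?_
  rcases Nat.eq_zero_or_pos (μ j) with h | h
  · simp [h, hη j 0 (by omega)]
  · rw [Finset.sum_eq_single 0]
    · simp
    · intro k _ hk
      rw [Nat.choose_eq_zero_of_lt (Nat.pos_of_ne_zero hk)]
      simp
    · intro h'
      exact absurd (Finset.mem_range.2 h) h'

/-- By Pascal's rule, row `r` applied to the shifted family plus `b j` times the family is row `r +
1`. A time derivative of the formula thus moves down one row. -/
theorem row_step {η : ι → ℕ → Y} (hη : ∀ j k, μ j ≤ k → η j k = 0) (r : ℕ) (β : K) :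
    m.row μ r (fun j k => η j (k + 1) + m.b j • η j k - β • η j k) =
      m.row μ (r + 1) η - β • m.row μ r η := by
  simp only [row, Finset.smul_sum, ← Finset.sum_sub_distrib]
  refine Finset.sum_congr rfl fun j _ => ?_
  have h1 : ∑ k ∈ Finset.range (μ j), ((Nat.choose (r + 1) k : K) * m.b j ^ (r + 1 - k) -
      (Nat.choose r k : K) * m.b j ^ (r - k) * m.b j) • η j k =
      ∑ k ∈ Finset.range (μ j), ((Nat.choose r k : K) * m.b j ^ (r - k)) • η j (k + 1) := by
    refine sum_range_of_succ_eq ?_ (fun k => ?_) fun k hk => ?_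
    · simp [pow_succ]
    · congr 1
      rw [Nat.choose_succ_succ, Nat.cast_add, Nat.add_sub_add_right, add_mul, add_sub_assoc,
        add_eq_left, sub_eq_zero]
      rcases lt_or_ge k r with h | h
      · rw [mul_assoc, ← pow_succ, show r - (k + 1) + 1 = r - k by omega]
      · rw [Nat.choose_eq_zero_of_lt (by omega : r < k + 1)]
        simp
    · rw [hη j (k + 1) (by omega), smul_zero]
  simp only [smul_sub, smul_add, Finset.sum_sub_distrib, Finset.sum_add_distrib, ← h1]
  simp only [sub_smul, Finset.sum_sub_distrib, smul_smul]
  rw [sub_add_cancel]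
  simp only [mul_comm β]

theorem row_famIter (hT : 0 ≤ T) {y : ι → ℕ → X} (hy : IsVec B μ n y) {α : ℕ → X → X}
    {β : ℕ → K} (hα : ∀ i, Lowers B T (α i))
    (hβ : ∀ i x, x ∈ smooth B 1 → m.e (α i x) = β i • m.e x) {k : ℕ} (hk : k < n) (r : ℕ) :
    m.row μ r (fun i p => m.e (famIter B α y (k + 1) i p)) =
      m.row μ (r + 1) (fun i p => m.e (famIter B α y k i p)) -
        β k • m.row μ r (fun i p => m.e (famIter B α y k i p)) := by
  have hv : IsVec B μ 1 (famIter B α y k) := by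
    have := hy.iter hT hα (N := n - k) (m := k) (by omega)
    exact ⟨fun j p => smooth_mono (by omega) (this.smooth j p), this.vanish⟩
  rw [← m.row_step (fun j p hp => by rw [hv.vanish j p hp, map_zero])]
  congr 1
  funext j p
  rw [famIter, famStep, map_sub, map_add, hβ k _ (hv.smooth j p), m.e_act (hv.smooth j p j).1]

/-- By `row_step` a factor moves the rows `(0,…,0,φ)` up by one; the subtracted multiples `β k` only
meet rows that are still zero. -/
theorem row_famIter_eq_ite (hT : 0 ≤ T) {y : ι → ℕ → X} (hy : IsVec B μ n y) {α : ℕ → X → X}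
    {β : ℕ → K} (hα : ∀ i, Lowers B T (α i))
    (hβ : ∀ i x, x ∈ smooth B 1 → m.e (α i x) = β i • m.e x) {φ : Y}
    (hφ : ∀ r < n, m.row μ r (fun i p => m.e (y i p)) = if r + 1 = n then φ else 0) {k r : ℕ}
    (hkr : k + r < n) :
    m.row μ r (fun i p => m.e (famIter B α y k i p)) = if k + r + 1 = n then φ else 0 := by
  induction k generalizing r with
  | zero => simpa [famIter] using hφ r (by omega)
  | succ k ih =>
    rw [m.row_famIter hT hy hα hβ (by omega), ih (by omega), ih (by omega),
      if_neg (by omega : ¬ k + r + 1 = n), smul_zero, sub_zero]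
    congr 2
    omega

theorem row_famIter_zero (hT : 0 ≤ T) {y : ι → ℕ → X} (hy : IsVec B μ n y) {k r : ℕ}
    (hkr : k + r ≤ n) : m.row μ r (fun i p => m.e (famIter B (fun _ _ => 0) y k i p)) =
      m.row μ (k + r) (fun i p => m.e (y i p)) := by
  induction k generalizing r with
  | zero => simp [famIter]
  | succ k ih =>
    rw [m.row_famIter hT hy (β := fun _ => 0) (fun _ => lowers_zero B T) (by simp) (by omega),
      ih (by omega), zero_smul, sub_zero, add_right_comm, add_assoc]

theorem smul_row_mem_range {y : ι → ℕ → X} {r N : ℕ} (hy : IsVec B μ N y) (hr : r < N) (i : ι) :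
    m.b i • m.row μ r (fun i p => m.e (y i p)) ∈ m.e.range := by
  rw [row, Finset.smul_sum]
  refine sum_mem fun j _ => ?_
  rw [Finset.smul_sum]
  refine sum_mem fun k _ => ?_
  rw [mul_smul, smul_comm, Nat.cast_smul_eq_nsmul]
  exact nsmul_mem (m.smul_pow_smul_mem_range (smooth_mono (by omega) (hy.smooth j k)) i j) _

/-- The recursion for the data is that of `row_step`, with `β k = b (a k)`. -/
theorem e_shiftedData (hT : 0 ≤ T) {σ : Fin n → ι} {a : ℕ → ι} (ha : ∀ i : Fin n, a i = σ i)
    {y : ι → ℕ → X} (hy : IsVec B μ n y) {x : Fin n → X}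
    (hx : ∀ r : Fin n, m.e (x r) = m.row μ r (fun i p => m.e (y i p))) {k r : ℕ}
    (hkr : k + r < n) : m.e (shiftedData B σ x k r) =
      m.row μ r (fun i p => m.e (famIter B (fun i => act (B (a i))) y k i p)) := by
  have hα : ∀ i, Lowers B T (act (B (a i))) := fun i => lowers_act B T _
  induction k generalizing r with
  | zero =>
    rw [shiftedData, dif_pos (by omega : r < n)]
    exact hx _
  | succ k ih =>
    have hk : k < n := by omega
    have hvec := hy.iter hT hα (N := n - k) (m := k) (by omega)
    -- The default value `0` of `act` must not occur here. That `b (a k)` maps the datum back into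
    -- `X` shows that the datum lies in the domain.
    obtain ⟨x', hx'⟩ := m.smul_row_mem_range hvec (r := r) (by omega) (a k)
    rw [← ih (by omega)] at hx'
    have hdom := ((m.act_iff _ _ _).1 hx'.symm).1
    rw [shiftedData, dif_pos hk, ← ha ⟨k, hk⟩, map_sub, m.e_act hdom, ih (by omega),
      ih (by omega), m.row_famIter hT hy hα (β := fun i => m.b (a i))
        (fun i x hx => m.e_act (hx (a i)).1) hk]

end Model

section Columns

variable [DecidableEq ι] (σ : Fin n → ι)

/-- Extension by zero of a family indexed by the columns. -/
def extendCol {W : Type*} [Zero W] (y : Col σ → W) (j : ι) (k : ℕ) : W :=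
  if h : k < mult σ j then y ⟨j, k, h⟩ else 0

theorem extendCol_eq_zero {W : Type*} [Zero W] (y : Col σ → W) {j : ι} {k : ℕ}
    (hk : mult σ j ≤ k) : extendCol σ y j k = 0 := dif_neg (not_lt.2 hk)

omit [NormedSpace ℝ X] in
theorem extendCol_apply (z : Col σ → ℝ → X) (j : ι) (k : ℕ) (t : ℝ) :
    extendCol σ z j k t = extendCol σ (fun c => z c t) j k := by
  unfold extendCol
  split_ifs <;> rfl

theorem extendCol_map (y : Col σ → X) (C : X →L[ℝ] X) (j : ι) (k : ℕ) :
    extendCol σ (fun c => C (y c)) j k = C (extendCol σ y j k) := by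
  unfold extendCol
  split_ifs <;> simp

theorem sum_col [Fintype ι] {W M : Type*} [Zero W] [AddCommMonoid M] (F : ι → ℕ → W → M)
    (y : Col σ → W) : ∑ c : Col σ, F c.1 c.2 (y c) =
      ∑ j, ∑ k ∈ Finset.range (mult σ j), F j k (extendCol σ y j k) := by
  rw [Fintype.sum_sigma]
  refine Finset.sum_congr rfl fun j _ => ?_
  rw [Finset.sum_range]
  refine Finset.sum_congr rfl fun k _ => ?_
  rw [extendCol, dif_pos k.2]

theorem isVec_extendCol {y : Col σ → X} (hy : ∀ c, y c ∈ smooth B n) :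
    IsVec B (mult σ) n (extendCol σ y) := by
  refine ⟨fun j k => ?_, fun j k hk => extendCol_eq_zero σ y hk⟩
  unfold extendCol
  split_ifs
  · exact hy _
  · exact (isVec_zero (B := B) (μ := mult σ) (N := n)).smooth j k

theorem isPath_extendCol {z : Col σ → ℝ → X} (hz : ∀ c, SmoothPath B T n (z c)) :
    IsPath B T (mult σ) n (extendCol σ z) := by
  refine ⟨fun j k => ?_, fun j k hk t _ => by rw [extendCol_eq_zero σ z hk]; rfl⟩
  unfold extendCol
  split_ifs
  · exact hz _
  · exact smoothPath_zero n

variable [Fintype ι]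

theorem Model.row_extendCol {K Y : Type*} [CommRing K] [AddCommGroup Y] [Module K Y]
    (m : Model B K Y) {y : Col σ → X} (hy : ∀ c, InDom B σ c (y c)) (r : Fin n) :
    m.row (mult σ) r (fun j k => m.e (extendCol σ y j k)) = m.e (mulM B σ y r) := by
  rw [m.e_mulM hy]
  exact (sum_col σ (fun j k w => ((Nat.choose r k : K) * m.b j ^ ((r : ℕ) - k)) • m.e w) y).symm

theorem homSol_eq_famSol (S : ι → C0Semigroup X) (y : Col σ → X) (t : ℝ) :
    homSol S σ y t = famSol S (mult σ) (extendCol σ y) (fun _ _ _ => 0) t := by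
  rw [famSol_zero_right]
  exact sum_col σ (fun j k w => expMono k t • (S j).toFun t.toNNReal w) y

theorem inhomSol_eq_famSol (S : ι → C0Semigroup X) (z : Col σ → ℝ → X) (t : ℝ) :
    inhomSol S σ z t = famSol S (mult σ) (fun _ _ => 0) (extendCol σ z) t := by
  rw [famSol_zero_left]
  exact sum_col σ (fun j k w => (S j).conv (expMono k) w t) z

end Columns

end FactoredCauchy

/-! ### From the formula to solutions -/

namespace FactoredCauchy

variable {X : Type*} [NormedAddCommGroup X] [NormedSpace ℝ X] {ι : Type*}
  {B : ι → X →ₗ.[ℝ] X} {T : ℝ} {n : ℕ}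

theorem IsChain.add (hT : 0 < T) {a : ℕ → ι} {v w : ℕ → ℝ → X} (hv : IsChain B T a n v)
    (hw : IsChain B T a n w) : IsChain B T a n (fun m t => v m t + w m t) := by
  intro m hm
  obtain ⟨h1, h2⟩ := hv m hm
  obtain ⟨h3, h4⟩ := hw m hm
  have hd : ∀ t ∈ Icc 0 T, HasDerivWithinAt (fun t => v m t + w m t)
      ((act (B (a m)) (v m t) + v (m + 1) t) + (act (B (a m)) (w m t) + w (m + 1) t))
      (Icc 0 T) t := fun t ht => (h1 t ht).2.add (h3 t ht).2
  refine ⟨fun t ht => ⟨(B (a m)).domain.add_mem (h1 t ht).1 (h3 t ht).1, ?_⟩, ?_⟩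
  · refine (hd t ht).congr_deriv ?_
    rw [act_add (h1 t ht).1 (h3 t ht).1]
    exact add_add_add_comm _ _ _ _
  · refine (h2.add h4).congr fun t ht => ?_
    have hu := uniqueDiffOn_Icc hT t ht
    rw [(hd t ht).derivWithin hu, Pi.add_apply, (h1 t ht).2.derivWithin hu,
      (h3 t ht).2.derivWithin hu]

theorem IsChain.isSolution {σ : Fin n → ι} {a : ℕ → ι} (ha : ∀ i : Fin n, a i = σ i)
    {v : ℕ → ℝ → X} (hv : IsChain B T a n v) {x : Fin n → X} {f u : ℝ → X}
    (hu : ∀ t ∈ Icc 0 T, v 0 t = u t) (hf : ∀ t ∈ Icc 0 T, v n t = f t)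
    (hv0 : ∀ m < n, v m 0 = shiftedData B σ x m 0)
    (hx : ∀ k : Fin n, ContDiffOn ℝ (k : ℕ) u (Icc 0 T) →
      iteratedDerivWithin k u (Icc 0 T) 0 = x k) : IsSolution B σ T x f u := by
  refine ⟨⟨v, hu, hf, fun m => ?_⟩, hx⟩
  rw [← ha m]
  exact ⟨(hv m m.2).1, (hv m m.2).2, hv0 m m.2⟩

theorem shiftedData_zero (σ : Fin n → ι) (m k : ℕ) :
    shiftedData B σ (fun _ => 0) m k = 0 := by
  induction m generalizing k with
  | zero => simp [shiftedData]
  | succ m ih => simp [shiftedData, ih, act_zero]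

omit [NormedSpace ℝ X] in
theorem lastVec_zero : lastVec n (0 : X) = fun _ => 0 := by
  funext r
  simp [lastVec]

section

variable [Fintype ι] [DecidableEq ι] {σ : Fin n → ι} [CompleteSpace X]
  {S : ι → C0Semigroup X} {l : ι → ℝ} {R : ι → X →L[ℝ] X}
  {K Y : Type*} [CommRing K] [AddCommGroup Y] [Module K Y]
  {y : Col σ → X} {z : Col σ → ℝ → X} {f : ℝ → X}

omit [CompleteSpace X] in
theorem row_extend_path (m : Model B K Y) (hz : ∀ c, SmoothPath B T n (z c))
    (hM : ∀ t ∈ Icc 0 T, mulM B σ (fun c => z c t) = lastVec n (f t)) {t : ℝ}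
    (ht : t ∈ Icc 0 T) (r : ℕ) (hr : r < n) :
    m.row (mult σ) r (fun j k => m.e (extendCol σ z j k t)) = if r + 1 = n then m.e (f t) else 0 := by
  simp only [extendCol_apply]
  rw [m.row_extendCol σ (fun c => inDom_of_smooth ((hz c).mem_smooth ht) c) ⟨r, hr⟩, hM t ht, lastVec]
  split_ifs
  · rfl
  · exact map_zero _

omit [CompleteSpace X] in
-- The boundary term of step `k` is row `0` of the family after `k` steps, hence an entry of
-- `(0,…,0,f)`.
theorem sum_pathIter (m : Model B K Y) (hT : 0 ≤ T) (hz : ∀ c, SmoothPath B T n (z c))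
    (hM : ∀ t ∈ Icc 0 T, mulM B σ (fun c => z c t) = lastVec n (f t)) {α : ℕ → X → X} {β : ℕ → K}
    (hα : ∀ i, Lowers B T (α i))
    (hβ : ∀ i x, x ∈ smooth B 1 → m.e (α i x) = β i • m.e x) {t : ℝ} (ht : t ∈ Icc 0 T)
    {k : ℕ} (hk : k < n) :
    ∑ j, pathIter B α (extendCol σ z) k j 0 t = if k + 1 = n then f t else 0 := by
  apply m.inj
  have hv := (isPath_extendCol σ hz).isVec ht
  have := m.row_famIter_eq_ite hT hv hα hβ (fun r hr => row_extend_path m hz hM ht r hr)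
    (k := k) (r := 0) (by omega)
  rw [m.row_zero fun j p hp => by
    rw [(hv.iter hT hα (N := n - k) (m := k) (by omega)).vanish j p hp, map_zero]] at this
  rw [map_sum]
  refine this.trans ?_
  rw [add_zero]
  split_ifs
  · rfl
  · exact (map_zero _).symm

/-- For smooth coefficients, the solution formula yields the chain of successive factors. -/
theorem exists_isChain (h : IsResolventFamily S B l R) (m : Model B K Y) (hT : 0 < T) (hn : 0 < n)
    {a : ℕ → ι} (ha : ∀ i : Fin n, a i = σ i) (hy : ∀ c, y c ∈ smooth B n)
    (hz : ∀ c, SmoothPath B T n (z c))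
    (hM : ∀ t ∈ Icc 0 T, mulM B σ (fun c => z c t) = lastVec n (f t)) :
    ∃ v, IsChain B T a n v ∧
      (∀ t ∈ Icc 0 T, v 0 t = famSol S (mult σ) (extendCol σ y) (extendCol σ z) t) ∧ v n = f ∧
      ∀ k < n, v k 0 = shiftedData B σ (mulM B σ y) k 0 := by
  have hu := uniqueDiffOn_Icc hT
  let α : ℕ → X → X := fun i => act (B (a i))
  have hα : ∀ i, Lowers B T (α i) := fun i => lowers_act B T _
  have hβ : ∀ i x, x ∈ smooth B 1 → m.e (α i x) = m.b (a i) • m.e x := fun i x hx =>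
    m.e_act (hx (a i)).1
  let y' := famIter B α (extendCol σ y)
  let z' := pathIter B α (extendCol σ z)
  let F : ℕ → ℝ → X := fun k => famSol S (mult σ) (y' k) (z' k)
  -- After `n` steps all columns are exhausted and `F n` is zero; `f` enters solely as the boundary
  -- term of the last step.
  let v : ℕ → ℝ → X := fun k => if k = n then f else F k
  have hyv : ∀ N k, N + k = n → IsVec B (mult σ) N (y' k) := fun N k hk =>
    (isVec_extendCol σ hy).iter hT.le hα hk
  have hzv : ∀ N k, N + k = n → IsPath B T (mult σ) N (z' k) := fun N k hk =>
    (isPath_extendCol σ hz).iter hα hk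
  have hcount : ∀ j, mult σ j = ((Finset.range n).filter fun i => a i = j).card := by
    intro j
    rw [mult, Finset.card_filter, Finset.card_filter, Finset.sum_range]
    simp only [ha]
  have hFn : ∀ t ∈ Icc 0 T, F n t = 0 := by
    intro t ht
    have e1 : ∀ j k, y' n j k = 0 := fun j k =>
      famIter_eq_zero (μ := mult σ) (fun j k hk => extendCol_eq_zero σ y hk) a n
        (by rw [← hcount j]; omega)
    have e2 : ∀ j k, ∀ t ∈ Icc 0 T, z' n j k t = 0 := fun j k t _ =>
      famIter_eq_zero (fun j k hk => by rw [extendCol_eq_zero σ z hk]; rfl)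
        a n (by rw [← hcount j]; omega)
    rw [show F n t = famSol S (mult σ) (fun _ _ => 0) (fun _ _ _ => 0) t from famSol_congr e1 e2 ht]
    simp [famSol_zero_right]
  have hd : ∀ k < n, ∀ t ∈ Icc 0 T, F k t ∈ (B (a k)).domain ∧
      HasDerivWithinAt (F k) (act (B (a k)) (F k t) + v (k + 1) t) (Icc 0 T) t := by
    intro k hk t ht
    have h1 := hyv (n - k - 1 + 1) k (by omega)
    have h2 := hzv (n - k - 1 + 1) k (by omega)
    refine ⟨(act_famSol h h1 h2 (a k) ht).1,
      (hasDerivWithinAt_famSol_act h hT.le h1 h2 (a k) ht).congr_deriv ?_⟩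
    have h3 : ∑ j, z' k j 0 t = _ := sum_pathIter m hT.le hz hM hα hβ ht hk
    rw [h3, add_right_inj]
    change F (k + 1) t + _ = _
    by_cases hkn : k + 1 = n
    · simp only [v, hkn, hFn t ht, zero_add, if_true]
    · simp only [v, if_neg hkn, add_zero]
  refine ⟨v, fun k hk => ?_, fun t _ => ?_, if_pos rfl, fun k hk => ?_⟩
  · have hvk : v k = F k := if_neg hk.ne
    rw [hvk]
    refine ⟨hd k hk, ?_⟩
    have h1 := hyv (n - k - 1 + 1) k (by omega)
    have h2 := hzv (n - k - 1 + 1) k (by omega)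
    refine ContinuousOn.congr ?_ fun t ht =>
      (hasDerivWithinAt_famSol h hT.le h1 h2 ht).derivWithin (hu t ht)
    refine ContinuousOn.add (continuousOn_famSol hT.le fun j p =>
      ((h2.step (lowers_zero B T)).smooth j p).continuousOn) ?_
    exact continuousOn_finsetSum _ fun j _ => (h2.smooth j 0).continuousOn
  · simp only [v, if_neg hn.ne]
    rfl
  · have hvk : v k = F k := if_neg hk.ne
    have hvan := (hyv (n - k) k (by omega)).vanish
    rw [hvk, show F k 0 = ∑ j, y' k j 0 from famSol_at_zero hvan]
    apply m.inj
    rw [map_sum, m.e_shiftedData hT.le ha (isVec_extendCol σ hy)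
      (fun r => (m.row_extendCol σ (fun c => inDom_of_smooth (hy c) c) r).symm) (by omega),
      m.row_zero fun j p hp => by
        rw [show famIter B (fun i => act (B (a i))) (extendCol σ y) k j p = 0 from hvan j p hp,
          map_zero]]

/-- For smooth coefficients, the solution formula is `n` times differentiable, with the derivatives
at `0` that are given by the operator matrix. -/
theorem contDiffOn_famSol (h : IsResolventFamily S B l R) (m : Model B K Y) (hT : 0 < T)
    (hy : ∀ c, y c ∈ smooth B n) (hz : ∀ c, SmoothPath B T n (z c))
    (hf : ContinuousOn f (Icc 0 T))
    (hM : ∀ t ∈ Icc 0 T, mulM B σ (fun c => z c t) = lastVec n (f t)) :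
    ContDiffOn ℝ n (famSol S (mult σ) (extendCol σ y) (extendCol σ z)) (Icc 0 T) ∧
      ∀ r : Fin n, iteratedDerivWithin r (famSol S (mult σ) (extendCol σ y) (extendCol σ z))
        (Icc 0 T) 0 = mulM B σ y r := by
  have hu := uniqueDiffOn_Icc hT
  -- With `α = 0` the steps are pure time derivatives, so that `F k` is the `k`-th derivative for `k
  -- < n`.
  let α : ℕ → X → X := fun _ _ => 0
  have hα : ∀ i, Lowers B T (α i) := fun i => lowers_zero B T
  let y' := famIter B α (extendCol σ y)
  let z' := pathIter B α (extendCol σ z)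
  let F : ℕ → ℝ → X := fun k => famSol S (mult σ) (y' k) (z' k)
  have hyv : ∀ N k, N + k = n → IsVec B (mult σ) N (y' k) := fun N k hk =>
    (isVec_extendCol σ hy).iter hT.le hα hk
  have hzv : ∀ N k, N + k = n → IsPath B T (mult σ) N (z' k) := fun N k hk =>
    (isPath_extendCol σ hz).iter hα hk
  have hd : ∀ k < n, ∀ t ∈ Icc 0 T,
      HasDerivWithinAt (F k) (F (k + 1) t + if k + 1 = n then f t else 0) (Icc 0 T) t := by
    intro k hk t ht
    refine (hasDerivWithinAt_famSol h hT.le (hyv (n - k - 1 + 1) k (by omega))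
      (hzv (n - k - 1 + 1) k (by omega)) ht).congr_deriv ?_
    have h3 : ∑ j, z' k j 0 t = _ := sum_pathIter m hT.le hz hM hα (β := fun _ => 0)
      (by simp [α]) ht hk
    rw [h3]
    rfl
  have hdw : ∀ k < n, EqOn (derivWithin (F k) (Icc 0 T))
      (fun t => F (k + 1) t + if k + 1 = n then f t else 0) (Icc 0 T) := fun k hk t ht =>
    (hd k hk t ht).derivWithin (hu t ht)
  constructor
  · suffices H : ∀ i ≤ n, ContDiffOn ℝ i (F (n - i)) (Icc 0 T) by
      have := H n le_rfl
      rw [Nat.sub_self] at this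
      exact this
    intro i
    induction i with
    | zero =>
      intro _
      exact contDiffOn_zero.2 (continuousOn_famSol hT.le fun j p =>
        ((hzv 0 n (by omega)).smooth j p).continuousOn)
    | succ i ih =>
      intro hi
      have hk : n - (i + 1) < n := by omega
      rw [Nat.cast_succ, contDiffOn_succ_iff_derivWithin hu]
      refine ⟨fun t ht => (hd _ hk t ht).differentiableWithinAt, by simp, ?_⟩
      refine ContDiffOn.congr ?_ (hdw _ hk)
      rw [show n - (i + 1) + 1 = n - i by omega]
      refine (ih (by omega)).add ?_
      rcases Nat.eq_zero_or_pos i with rfl | hi0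
      · have hf' : ContDiffOn ℝ 0 f (Icc 0 T) := contDiffOn_zero.2 hf
        simpa using hf'
      · simp only [if_neg (by omega : ¬ n - i = n)]
        exact contDiffOn_const
  · have key : ∀ r k, k + r < n → ∀ t ∈ Icc 0 T,
        iteratedDerivWithin r (F k) (Icc 0 T) t = F (k + r) t := by
      intro r
      induction r with
      | zero =>
        intro k _ t _
        simp
      | succ r ih =>
        intro k hk t ht
        rw [iteratedDerivWithin_succ', iteratedDerivWithin_congr (hdw k (by omega)) ht]
        simp only [if_neg (by omega : ¬ k + 1 = n), add_zero]
        rw [ih (k + 1) (by omega) t ht, add_right_comm, add_assoc]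
    intro r
    refine (key r 0 (by omega) 0 ⟨le_rfl, hT.le⟩).trans ?_
    rw [zero_add]
    have hvan := (hyv (n - r) r (by omega)).vanish
    rw [show F r 0 = ∑ j, y' r j 0 from famSol_at_zero hvan]
    apply m.inj
    rw [map_sum, ← m.row_zero (μ := mult σ) (η := fun j k => m.e (y' r j k)) fun j p hp => by
        rw [hvan j p hp, map_zero],
      ← m.row_extendCol σ (fun c => inDom_of_smooth (hy c) c) r]
    exact m.row_famIter_zero hT.le (isVec_extendCol σ hy) (by omega)

/-- Applying `Q ^ n` makes `z` smooth. The formula then yields a chain with zero data ending in `Q ^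
n f`, and so does `w` after `Q ^ n`. Chains with zero data are unique, and `Q ^ n` is injective. -/
theorem famSol_eq_of_isChain (h : IsResolventFamily S B l R) (m : Model B K Y) (hT : 0 < T)
    (hn : 0 < n) {a : ℕ → ι} (ha : ∀ i : Fin n, a i = σ i) (hz : ∀ c, ContinuousOn (z c) (Icc 0 T))
    (hzd : ∀ c, ∀ t ∈ Icc 0 T, InDom B σ c (z c t)) (hf : ContinuousOn f (Icc 0 T))
    (hM : ∀ t ∈ Icc 0 T, mulM B σ (fun c => z c t) = lastVec n (f t)) {w : ℕ → ℝ → X}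
    (hw : IsChain B T a n w) (hw0 : ∀ k < n, w k 0 = 0) (hwn : w n = f) :
    ∀ t ∈ Icc 0 T, w 0 t = famSol S (mult σ) (fun _ _ => 0) (extendCol σ z) t := by
  obtain ⟨Q, h1, h2, h3⟩ := h.exists_smoothing
  have hQn : Q ^ n ∈ bicommutantRing R := pow_mem h1 n
  have hQR := h.commute_mem_resolvent hQn
  have hinj : Function.Injective (Q ^ n) := by
    rw [FunLike.coe_pow_eq_iterate]
    exact h2.iterate n
  have hM' : ∀ t ∈ Icc 0 T, mulM B σ (fun c => (Q ^ n) (z c t)) = lastVec n ((Q ^ n) (f t)) := by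
    intro t ht
    rw [h.mulM_map hQR fun c => hzd c t ht, hM t ht]
    funext r
    simp only [lastVec]
    split_ifs <;> simp
  have hzero : mulM B σ (fun _ => (0 : X)) = fun _ => 0 := by
    have := h.mulM_map (C := 0) (y := fun _ : Col σ => (0 : X)) (fun j => Commute.zero_left _)
      fun c => inDom_of_smooth ((isVec_zero (B := B) (μ := mult σ) (N := n)).smooth c.1 0) c
    simpa using this
  obtain ⟨v, v1, v2, v3, v4⟩ := exists_isChain h m hT hn ha (y := fun _ => 0)
    (fun c => (isVec_zero (B := B) (μ := mult σ) (N := n)).smooth c.1 0)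
    (fun c => h.smoothPath_smoothing h1 h3 n (hz c)) hM'
  have hfc : ContinuousOn (fun t => (Q ^ n) (f t)) (Icc 0 T) :=
    (Q ^ n).continuous.comp_continuousOn hf
  have key := IsChain.eqOn h hT v1 (hw.map h hT hQR)
    (fun k hk => by rw [v4 k hk, hzero, shiftedData_zero])
    (fun k hk => by rw [hw0 k hk, map_zero]) (by rw [v3]; exact hfc)
    (fun t _ => by rw [v3, hwn]) (Nat.zero_le n)
  intro t ht
  apply hinj
  rw [← key t ht, v2 t ht]
  have hzc : ∀ j k, ContinuousOn (extendCol σ z j k) (Icc 0 T) := by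
    intro j k
    unfold extendCol
    split_ifs
    · exact hz _
    · exact continuousOn_const
  rw [← famSol_map (fun j => h.commute_mem_toFun hQn j) hzc ht]
  refine famSol_congr (fun j k => ?_) (fun j k s _ => ?_) ht
  · unfold extendCol
    split_ifs <;> simp
  · rw [extendCol_apply, extendCol_apply, extendCol_map σ (fun c => z c s)]

end

end FactoredCauchy

end

open FactoredCauchy in
theorem corollary3 {X : Type*} [NormedAddCommGroup X] [NormedSpace ℝ X] [CompleteSpace X]
    {ι : Type*} [Fintype ι] [DecidableEq ι] {n : ℕ} (hn : 0 < n)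
    (S : ι → C0Semigroup X) (B : ι → X →ₗ.[ℝ] X) (hB : ∀ j, B j = (S j).generator)
    (σ : Fin n → ι) (hσ : Function.Surjective σ) (T : ℝ) (hT : 0 < T)
    (hA0 : ∀ j k : ι, ∀ s t : ℝ≥0,
      ((S j).toFun t).comp ((S k).toFun s) = ((S k).toFun s).comp ((S j).toFun t))
    (hA1 : ∀ j k : ι, j ≠ k → Function.Injective (B j - B k)) :
    -- the operator matrix is injective
    (∀ y y' : Col σ → X, (∀ c, InDom B σ c (y c)) → (∀ c, InDom B σ c (y' c)) →
      mulM B σ y = mulM B σ y' → y = y') ∧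
    -- data in the range of a suitable product of the differences are in its range
    (∃ L : List (ι × ι), (∀ q ∈ L, q.1 ≠ q.2) ∧ ∃ N : ℕ,
      (∀ x : Fin n → X, (∀ r, ∃ v ∈ smooth B N, diffProd B L v = x r) →
        ∃ y : Col σ → X, (∀ c, y c ∈ smooth B n) ∧ mulM B σ y = x) ∧
      (∀ f : ℝ → X, (∃ g : ℝ → X, SmoothPath B T N g ∧ ∀ t ∈ Icc 0 T, diffProd B L (g t) = f t) →
        ∃ z : Col σ → ℝ → X, (∀ c, SmoothPath B T n (z c)) ∧
          ∀ t ∈ Icc 0 T, mulM B σ (fun c => z c t) = lastVec n (f t))) ∧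
    -- the solution formula, for all data in the range of the matrix
    (∀ (x : Fin n → X) (f : ℝ → X) (y : Col σ → X) (z : Col σ → ℝ → X),
      H1 B T f →
      (∀ c, y c ∈ smooth B n) → mulM B σ y = x →
      (∀ c, ContinuousOn (z c) (Icc 0 T)) → (∀ c, ∀ t ∈ Icc 0 T, InDom B σ c (z c t)) →
      (∀ t ∈ Icc 0 T, mulM B σ (fun c => z c t) = lastVec n (f t)) →
      IsSolution B σ T x (fun _ => 0) (homSol S σ y) ∧
      IsSolution B σ T (fun _ => 0) f (inhomSol S σ z) ∧
      IsSolution B σ T x f (fun t => homSol S σ y t + inhomSol S σ z t) ∧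
      ContDiffOn ℝ n (homSol S σ y) (Icc 0 T) ∧
      ((∀ c, SmoothPath B T n (z c)) →
        ContDiffOn ℝ n (fun t => homSol S σ y t + inhomSol S σ z t) (Icc 0 T))) := by
  obtain ⟨l, R, h⟩ := exists_isResolventFamily S B hB hA0
  obtain ⟨m⟩ := exists_model h hA1
  have hu := uniqueDiffOn_Icc hT
  have h0 : (0 : ℝ) ∈ Icc 0 T := ⟨le_rfl, hT.le⟩
  refine ⟨fun y y' hy hy' e => m.mulM_injective hy hy' e, m.exists_range hT.le, ?_⟩
  rintro x f y z ⟨hf1, -⟩ hy rfl hz hzd hM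
  have hfc := hf1.continuousOn
  -- The value beyond `n` is immaterial; it only makes `σ` a function on all of `ℕ`.
  let a : ℕ → ι := fun i => if hi : i < n then σ ⟨i, hi⟩ else σ ⟨0, hn⟩
  have ha : ∀ i : Fin n, a i = σ i := fun i => dif_pos i.2
  have hext0 : extendCol σ (fun _ _ => 0 : Col σ → ℝ → X) = fun _ _ _ => 0 := by
    funext j k t
    rw [extendCol_apply]
    unfold extendCol
    split_ifs <;> rfl
  have hzero : mulM B σ (fun _ => (0 : X)) = fun _ => 0 := by
    have := h.mulM_map (C := 0) (y := fun _ : Col σ => (0 : X)) (fun j => Commute.zero_left _)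
      fun c => inDom_of_smooth ((isVec_zero (B := B) (μ := mult σ) (N := n)).smooth c.1 0) c
    simpa using this
  have hM0 : ∀ t ∈ Icc 0 T, mulM B σ (fun c => (fun _ _ => 0 : Col σ → ℝ → X) c t) =
      lastVec n ((fun _ => 0 : ℝ → X) t) := fun t _ => by rw [hzero, lastVec_zero]
  have hhom : homSol S σ y =
      famSol S (mult σ) (extendCol σ y) (extendCol σ (fun _ _ => 0 : Col σ → ℝ → X)) := by
    funext t
    rw [homSol_eq_famSol, hext0]
  obtain ⟨hcd, hder⟩ := contDiffOn_famSol h m hT hy (z := fun _ _ => 0)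
    (fun _ => smoothPath_zero n) continuousOn_const hM0
  obtain ⟨v, v1, v2, v3, v4⟩ := exists_isChain h m hT hn ha hy (z := fun _ _ => 0)
    (fun _ => smoothPath_zero n) hM0
  rw [← hhom] at hcd hder v2
  -- This chain comes from `f` alone; only `hin` connects it with the coefficients `z`.
  obtain ⟨w, w1, w2, w3⟩ := IsChain.exists_of_contDiffOn h hT a n hf1
  have hin : ∀ t ∈ Icc 0 T, w 0 t = inhomSol S σ z t := fun t ht => by
    rw [inhomSol_eq_famSol]
    exact famSol_eq_of_isChain h m hT hn ha hz hzd hfc hM w1 w2 w3 t ht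
  have hinder : ∀ k : Fin n, ContDiffOn ℝ (k : ℕ) (inhomSol S σ z) (Icc 0 T) →
      iteratedDerivWithin k (inhomSol S σ z) (Icc 0 T) 0 = 0 := by
    intro k hk
    have he : EqOn (w 0) (inhomSol S σ z) (Icc 0 T) := hin
    rw [← iteratedDerivWithin_congr he h0]
    exact IsChain.iteratedDerivWithin_eq_zero h hT w1 w2 k.2 (hk.congr he)
  have hcdk : ∀ k : Fin n, ContDiffOn ℝ (k : ℕ) (homSol S σ y) (Icc 0 T) := fun k =>
    hcd.of_le (by exact_mod_cast k.2.le)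
  refine ⟨v1.isSolution ha v2 (fun t _ => by rw [v3]) v4 fun k _ => hder k,
    w1.isSolution ha hin (fun t _ => by rw [w3])
      (fun k hk => by rw [w2 k hk, shiftedData_zero]) hinder, ?_, hcd, fun hzs => ?_⟩
  · refine (v1.add hT w1).isSolution ha (fun t ht => by rw [v2 t ht, hin t ht])
      (fun t _ => by rw [v3, w3, zero_add]) (fun k hk => by rw [w2 k hk, add_zero, v4 k hk])
      fun k hk => ?_
    -- The homogeneous part is `C^n`, so any smoothness of order `k < n` of the sum passes to the
    -- inhomogeneous part.
    have hp : ContDiffOn ℝ (k : ℕ) (inhomSol S σ z) (Icc 0 T) :=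
      (hk.sub (hcdk k)).congr fun t _ => by simp
    rw [iteratedDerivWithin_fun_add h0 hu (hcdk k 0 h0) (hp 0 h0), hder k, hinder k hp, add_zero]
  · refine (hcd.add (contDiffOn_famSol (y := fun _ => 0) h m hT
      (fun c => (isVec_zero (B := B) (μ := mult σ) (N := n)).smooth c.1 0) hzs hfc hM).1).congr
      fun t _ => ?_
    rw [inhomSol_eq_famSol]
    congr 2
    funext j k
    unfold extendCol
    split_ifs <;> rfl
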